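/- Let $k$ be a field, $Q$ a finite quiver and $I$ an admissible ideal of the path algebra $kQ$ (paths are composed from left to right), that is, $J^m\subseteq I\subseteq J^2$ for some $m\ge 2$, where $J$ is the ideal generated by the arrows. Let $\Lambda=kQ/I$. For a finite-dimensional algebra $R$ let $\operatorname{findim}R$ be the supremum of the projective dimensions of the finitely generated right $R$-modules of finite projective dimension. For a set $A$ of arrows, we say that the arrows in $A$ do not occur in a set of minimal generators of $I$ if there is a generating set $S$ of the two-sided ideal $I$, no proper subset of which generates $I$, such that no path through an arrow of $A$ has a nonzero coefficient in an element of $S$. (i) Let $a\colon v_e\to v_f$ be an arrow, with $e$ and $f$ the trivial paths at its start and its end, let $\Gamma=\Lambda/\langle\bar a\rangle$, and let $\Gamma\ltimes(\Gamma e\otimes_k f\Gamma)$ be the trivial extension by the bimodule $\Gamma e\otimes_k f\Gamma$. (a) The arrow $a$ does not occur in a set of minimal generators of $I$ if and only if $\operatorname{Hom}_\Gamma(e\Gamma,f\Gamma)=0$ and there is an isomorphism of $k$-algebras $\varphi\colon\Lambda\to\Gamma\ltimes(\Gamma e\otimes_k f\Gamma)$ that is the identity on $\Gamma$, i.e. sends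 the class of every path $p$ that does not run through $a$ (trivial paths included) to $(\bar p,0)$. In that case $\varphi$ can be chosen such that moreover $\varphi(\bar a)=(0,e\otimes f)$. (b) One has $\operatorname{Hom}_\Gamma(e\Gamma,f\Gamma)=0$ and $\Lambda\cong\Gamma\ltimes(\Gamma e\otimes_k f\Gamma)$ by an arbitrary isomorphism of $k$-algebras if and only if there is an admissible ideal $I'$ of $kQ$ such that $kQ/I'\cong\Lambda$ as $k$-algebras, $I'+\langle a\rangle=I+\langle a\rangle$ (so that removing $a$ from $kQ/I'$ also gives $\Gamma$), and $a$ does not occur in a set of minimal generators of $I'$. (ii) If the arrow $a$ does not occur in a set of minimal generators of $I$, then, with $\Gamma=\Lambda/\langle\bar a\rangle$, $\operatorname{findim}\Lambda\le\max\{\operatorname{findim}\Gamma,1\}$ and $\operatorname{findim}\Gamma\le\max\{\operatorname{findim}\Lambda,1\}$; in particular $\operatorname{findim}\Lambda<\infty$ if and only if $\operatorname{findim}\Gamma<\infty$. More generally, let $a_i\colon v_{e_i}\to v_{f_i}$ $(i=1,\dots,t)$ be arrows that do not occur in a (common) set of minimal generators of $I$, with $\operatorname{Hom}_\Lambda(e_i\Lambda,f_j\Lambda)=0$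 for all $i,j$. Then the same inequalities and the same equivalence hold for $\Gamma=\Lambda/\langle\bar a_1,\dots,\bar a_t\rangle$. -/

import Mathlib

open CategoryTheory TensorProduct
open scoped MulOpposite

universe u v w

/-! ### Path algebras. Paths are composed from left to right: `p * q` is "first `p`, then `q`". -/

/-- The paths of a quiver, including the trivial ones; `⟨i, j, p⟩` is a path `p` from `i` to `j`. -/
abbrev QPath (V : Type u) [Quiver.{v} V] : Type (max u v) :=
  Σ i j : V, Quiver.Path i j

/-- The arrows of a quiver; `⟨i, j, a⟩` is an arrow `a : i ⟶ j`. -/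
abbrev QArrow (V : Type u) [Quiver.{v} V] : Type (max u v) :=
  Σ i j : V, (i ⟶ j)

/-- The path `p` runs through the arrow `a`. -/
def QPath.Contains {V : Type u} [Quiver.{v} V] (p : QPath V) (a : QArrow V) : Prop :=
  ∃ (q : Quiver.Path p.1 a.1) (r : Quiver.Path a.2.1 p.2.1), p.2.2 = (q.cons a.2.2).comp r

/-- The underlying vector space of the path algebra `kQ`: the paths of `Q` are a basis. -/
def PathAlgebra (k : Type w) (V : Type u) [Quiver.{v} V] [Field k] : Type (max u v w) :=
  QPath V →₀ k

namespace PathAlgebra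

noncomputable section

variable {k : Type w} {V : Type u} [Quiver.{v} V] [Field k]

instance : AddCommGroup (PathAlgebra k V) := inferInstanceAs (AddCommGroup (QPath V →₀ k))

instance : Module k (PathAlgebra k V) := inferInstanceAs (Module k (QPath V →₀ k))

/-- The basis element given by a path. -/
def path (k : Type w) [Field k] (p : QPath V) : PathAlgebra k V :=
  (Finsupp.single p 1 : QPath V →₀ k)

/-- The trivial path (the idempotent) at a vertex. -/
def vertex (k : Type w) [Field k] (i : V) : PathAlgebra k V := path k ⟨i, i, Quiver.Path.nil⟩

/-- An arrow, viewed as an element of the path algebra. -/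
def arrow (k : Type w) [Field k] (a : QArrow V) : PathAlgebra k V :=
  path k ⟨a.1, a.2.1, a.2.2.toPath⟩

/-- The coefficients of an element with respect to the basis of paths. -/
def coeffs (x : PathAlgebra k V) : QPath V →₀ k := x

open Classical in
/-- The product of two paths: the concatenation if the first ends where the second starts, and
zero otherwise. -/
def pathMul (k : Type w) [Field k] (p q : QPath V) : PathAlgebra k V :=
  if h : p.2.1 = q.1 then path k ⟨p.1, q.2.1, p.2.2.comp (q.2.2.cast h.symm rfl)⟩ else 0

/-- The bilinear extension of the product of paths. -/
def mulBilin (k : Type w) (V : Type u) [Quiver.{v} V] [Field k] :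
    PathAlgebra k V →ₗ[k] PathAlgebra k V →ₗ[k] PathAlgebra k V :=
  Finsupp.linearCombination k fun p : QPath V =>
    (Finsupp.linearCombination k fun q : QPath V => pathMul k p q :
      (QPath V →₀ k) →ₗ[k] PathAlgebra k V)

instance : Mul (PathAlgebra k V) := ⟨fun x y => mulBilin k V x y⟩

theorem mul_def (x y : PathAlgebra k V) : x * y = mulBilin k V x y := rfl

theorem mulBilin_path (p q : QPath V) :
    mulBilin k V (path k p) (path k q) = pathMul k p q := by
  unfold mulBilin path
  erw [Finsupp.linearCombination_single, one_smul, Finsupp.linearCombination_single, one_smul]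

theorem path_mul_path (p q : QPath V) : path k p * path k q = pathMul k p q :=
  mulBilin_path p q

theorem mul_add' (x y z : PathAlgebra k V) : x * (y + z) = x * y + x * z :=
  (mulBilin k V x).map_add y z

theorem add_mul' (x y z : PathAlgebra k V) : (x + y) * z = x * z + y * z :=
  (mulBilin k V).map_add₂ x y z

theorem mul_smul' (c : k) (x y : PathAlgebra k V) : x * (c • y) = c • (x * y) :=
  (mulBilin k V x).map_smul c y

theorem smul_mul' (c : k) (x y : PathAlgebra k V) : (c • x) * y = c • (x * y) :=
  (mulBilin k V).map_smul₂ c x y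

theorem mul_zero' (x : PathAlgebra k V) : x * 0 = 0 := (mulBilin k V x).map_zero

theorem zero_mul' (x : PathAlgebra k V) : 0 * x = 0 := (mulBilin k V).map_zero₂ x

theorem induction_path {P : PathAlgebra k V → Prop} (x : PathAlgebra k V) (h0 : P 0)
    (hadd : ∀ y z, P y → P z → P (y + z)) (hp : ∀ (c : k) (p : QPath V), P (c • path k p)) :
    P x := by
  refine Finsupp.induction_linear (motive := P) x h0 hadd fun p c => ?_
  have h := hp c p
  unfold path at h
  erw [Finsupp.smul_single, smul_eq_mul, mul_one] at h
  exact h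

theorem path_mul_path_mul_path (p q r : QPath V) :
    path k p * path k q * path k r = path k p * (path k q * path k r) := by
  obtain ⟨i, j, p⟩ := p
  obtain ⟨i', j', q⟩ := q
  obtain ⟨i'', j'', r⟩ := r
  by_cases h : j = i'
  · subst h
    by_cases h' : j' = i''
    · subst h'
      simp [path_mul_path, pathMul]
    · simp [path_mul_path, pathMul, h', mul_zero']
  · by_cases h' : j' = i''
    · subst h'
      simp [path_mul_path, pathMul, h, zero_mul']
    · simp [path_mul_path, pathMul, h', h, zero_mul', mul_zero']

theorem mul_assoc' (x y z : PathAlgebra k V) : x * y * z = x * (y * z) := by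
  induction x using induction_path with
  | h0 => simp only [zero_mul']
  | hadd x₁ x₂ h₁ h₂ => simp only [add_mul', h₁, h₂]
  | hp c p =>
    induction y using induction_path with
    | h0 => simp only [zero_mul', mul_zero']
    | hadd x₁ x₂ h₁ h₂ => simp only [add_mul', mul_add', h₁, h₂]
    | hp c q =>
      induction z using induction_path with
      | h0 => simp only [mul_zero']
      | hadd x₁ x₂ h₁ h₂ => simp only [mul_add', h₁, h₂]
      | hp c r => simp only [mul_smul', smul_mul', path_mul_path_mul_path]

theorem sum_mul' {ι : Type*} (s : Finset ι) (f : ι → PathAlgebra k V) (x : PathAlgebra k V) :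
    (∑ i ∈ s, f i) * x = ∑ i ∈ s, f i * x := by
  simp only [mul_def, map_sum, LinearMap.sum_apply]

theorem mul_sum' {ι : Type*} (s : Finset ι) (f : ι → PathAlgebra k V) (x : PathAlgebra k V) :
    x * (∑ i ∈ s, f i) = ∑ i ∈ s, x * f i := by
  simp only [mul_def, map_sum]

variable [Fintype V]

instance : One (PathAlgebra k V) := ⟨∑ i : V, vertex k i⟩

theorem one_def : (1 : PathAlgebra k V) = ∑ i : V, vertex k i := rfl

theorem one_mul' (x : PathAlgebra k V) : 1 * x = x := by
  induction x using induction_path with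
  | h0 => simp only [mul_zero']
  | hadd x₁ x₂ h₁ h₂ => simp only [mul_add', h₁, h₂]
  | hp c p =>
    obtain ⟨i, j, p⟩ := p
    rw [mul_smul', one_def, sum_mul', Finset.sum_eq_single i]
    · simp [vertex, path_mul_path, pathMul]
    · intro l _ hl
      simp [vertex, path_mul_path, pathMul, hl]
    · simp

theorem mul_one' (x : PathAlgebra k V) : x * 1 = x := by
  induction x using induction_path with
  | h0 => simp only [zero_mul']
  | hadd x₁ x₂ h₁ h₂ => simp only [add_mul', h₁, h₂]
  | hp c p =>
    obtain ⟨i, j, p⟩ := p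
    rw [smul_mul', one_def, mul_sum', Finset.sum_eq_single j]
    · simp [vertex, path_mul_path, pathMul]
    · intro l _ hl
      simp [vertex, path_mul_path, pathMul, Ne.symm hl]
    · simp

instance : Ring (PathAlgebra k V) :=
  { (inferInstance : AddCommGroup (PathAlgebra k V)) with
    mul := (· * ·)
    one := 1
    mul_assoc := mul_assoc'
    one_mul := one_mul'
    mul_one := mul_one'
    left_distrib := mul_add'
    right_distrib := add_mul'
    zero_mul := zero_mul'
    mul_zero := mul_zero' }

instance : Algebra k (PathAlgebra k V) := Algebra.ofModule smul_mul' mul_smul'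

end

end PathAlgebra

/-! ### Admissible ideals, generating sets, and the algebras `kQ/I` and `(kQ/I)/⟨A⟩` -/

section QuiverAlgebra

variable {k : Type w} {V : Type u} [Quiver.{v} V] [Field k] [Fintype V]

/-- The arrow ideal `J` of `kQ`. -/
noncomputable def arrowIdeal (k : Type w) (V : Type u) [Quiver.{v} V] [Field k] [Fintype V] :
    TwoSidedIdeal (PathAlgebra k V) :=
  TwoSidedIdeal.span (Set.range (PathAlgebra.arrow k))

/-- `I` is admissible: `J ^ m ⊆ I ⊆ J ^ 2` for some `m ≥ 2`. -/
def IsAdmissible (I : TwoSidedIdeal (PathAlgebra k V)) : Prop :=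
  I.asIdeal ≤ (arrowIdeal k V).asIdeal ^ 2 ∧
    ∃ m : ℕ, 2 ≤ m ∧ (arrowIdeal k V).asIdeal ^ m ≤ I.asIdeal

/-- `S` is a minimal generating set of the two-sided ideal `I`: it generates `I`, and no proper
subset of it does. -/
def IsMinimalGeneratingSet {R : Type*} [Ring R] (I : TwoSidedIdeal R) (S : Set R) : Prop :=
  TwoSidedIdeal.span S = I ∧ ∀ T : Set R, T ⊂ S → TwoSidedIdeal.span T ≠ I

/-- The arrow `a` occurs in `x`: some path with a nonzero coefficient in `x` runs through `a`. -/
def PathAlgebra.Involves (x : PathAlgebra k V) (a : QArrow V) : Prop :=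
  ∃ p ∈ x.coeffs.support, p.Contains a

/-- The arrows in `A` do not occur in a set of minimal generators of `I`: there is a minimal
generating set of `I` in whose elements none of these arrows occurs. -/
def AvoidsArrows (I : TwoSidedIdeal (PathAlgebra k V)) (A : Set (QArrow V)) : Prop :=
  ∃ S, IsMinimalGeneratingSet I S ∧ ∀ x ∈ S, ∀ a ∈ A, ¬ x.Involves a

/-- The algebra `kQ/I`. -/
abbrev QuiverAlgebra (I : TwoSidedIdeal (PathAlgebra k V)) : Type (max u v w) :=
  PathAlgebra k V ⧸ I.asIdeal

/-- The class of an element of `kQ` in `kQ/I`. -/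
noncomputable abbrev QuiverAlgebra.cls (I : TwoSidedIdeal (PathAlgebra k V)) (x : PathAlgebra k V) :
    QuiverAlgebra I :=
  Ideal.Quotient.mk I.asIdeal x

/-- The two-sided ideal of `kQ/I` generated by the classes of the arrows in `A`. -/
noncomputable def removalIdeal (I : TwoSidedIdeal (PathAlgebra k V)) (A : Set (QArrow V)) :
    TwoSidedIdeal (QuiverAlgebra I) :=
  TwoSidedIdeal.span ((fun a => QuiverAlgebra.cls I (PathAlgebra.arrow k a)) '' A)

/-- The quotient of `Λ = kQ/I` by the ideal generated by the classes of the arrows in `A`. -/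
abbrev ArrowRemoval (I : TwoSidedIdeal (PathAlgebra k V)) (A : Set (QArrow V)) :
    Type (max u v w) :=
  QuiverAlgebra I ⧸ (removalIdeal I A).asIdeal

/-- The class of an element of `kQ` in `(kQ/I)/⟨A⟩`. -/
noncomputable abbrev ArrowRemoval.cls (I : TwoSidedIdeal (PathAlgebra k V)) (A : Set (QArrow V))
    (x : PathAlgebra k V) : ArrowRemoval I A :=
  Ideal.Quotient.mk (removalIdeal I A).asIdeal (QuiverAlgebra.cls I x)

end QuiverAlgebra

/-! ### Right modules `eR`, the bimodule `Re ⊗ fR`, finitistic dimension -/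

/-- The left module `Re`. -/
abbrev leftSpan (R : Type u) [Ring R] (e : R) : Submodule R R := Submodule.span R {e}

/-- The right module `fR`. -/
abbrev rightSpan (R : Type u) [Ring R] (f : R) : Submodule Rᵐᵒᵖ R := Submodule.span Rᵐᵒᵖ {f}

/-- `Hom_R(eR, fR) = 0`, for right modules. -/
def HomVanishes (R : Type u) [Ring R] (e f : R) : Prop :=
  ∀ g : rightSpan R e →ₗ[Rᵐᵒᵖ] rightSpan R f, g = 0

/-- The `R`-`R`-bimodule `Re ⊗ₖ fR`. -/
def ProjBimodule (k : Type w) {R : Type u} [Field k] [Ring R] [Algebra k R] (e f : R) : Type u :=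
  leftSpan R e ⊗[k] rightSpan R f

namespace ProjBimodule

noncomputable section

variable {k : Type w} {R : Type u} [Field k] [Ring R] [Algebra k R] {e f : R}

instance : AddCommGroup (ProjBimodule k e f) :=
  inferInstanceAs (AddCommGroup (leftSpan R e ⊗[k] rightSpan R f))

instance : Module k (ProjBimodule k e f) :=
  inferInstanceAs (Module k (leftSpan R e ⊗[k] rightSpan R f))

/-- The elementary tensor `x ⊗ y`. -/
def tmul (x : leftSpan R e) (y : rightSpan R f) : ProjBimodule k e f := x ⊗ₜ[k] y

/-- The element `e ⊗ f`. -/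
def gen (k : Type w) {R : Type u} [Field k] [Ring R] [Algebra k R] (e f : R) :
    ProjBimodule k e f :=
  tmul ⟨e, Submodule.mem_span_singleton_self e⟩ ⟨f, Submodule.mem_span_singleton_self f⟩

/-- The left action `r • (x ⊗ y) = (r * x) ⊗ y`. -/
instance : Module R (ProjBimodule k e f) :=
  inferInstanceAs (Module R (leftSpan R e ⊗[k] rightSpan R f))

/-- The right action `(x ⊗ y) • r = x ⊗ (y * r)`. -/
instance : Module Rᵐᵒᵖ (ProjBimodule k e f) :=
  Module.compHom (leftSpan R e ⊗[k] rightSpan R f)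
    ((Module.End.lTensorAlgHom k (rightSpan R f) (leftSpan R e)).comp
      (Algebra.lsmul k k (rightSpan R f) : Rᵐᵒᵖ →ₐ[k] _)).toRingHom

theorem smul_tmul' (r : R) (x : leftSpan R e) (y : rightSpan R f) :
    r • (tmul x y : ProjBimodule k e f) = tmul (r • x) y := rfl

theorem op_smul_tmul (r : Rᵐᵒᵖ) (x : leftSpan R e) (y : rightSpan R f) :
    r • (tmul x y : ProjBimodule k e f) = tmul x (r • y) := rfl

theorem induction_tmul {P : ProjBimodule k e f → Prop} (x : ProjBimodule k e f) (h0 : P 0)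
    (hadd : ∀ y z, P y → P z → P (y + z)) (ht : ∀ x y, P (tmul x y)) : P x :=
  TensorProduct.induction_on (motive := P) x h0 ht hadd

instance : SMulCommClass R Rᵐᵒᵖ (ProjBimodule k e f) where
  smul_comm r s x := by
    induction x using induction_tmul with
    | h0 => simp only [smul_zero]
    | hadd x y hx hy => simp only [smul_add, hx, hy]
    | ht x y => simp only [smul_tmul', op_smul_tmul]

theorem base_smul_tmul (c : k) (x : leftSpan R e) (y : rightSpan R f) :
    c • (tmul x y : ProjBimodule k e f) = tmul (c • x) y := rfl

instance : IsScalarTower k R (ProjBimodule k e f) where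
  smul_assoc c r x := by
    induction x using induction_tmul with
    | h0 => simp only [smul_zero]
    | hadd x y hx hy => simp only [smul_add, hx, hy]
    | ht x y => simp only [smul_tmul', base_smul_tmul, smul_assoc]

instance : IsScalarTower k Rᵐᵒᵖ (ProjBimodule k e f) where
  smul_assoc c r x := by
    induction x using induction_tmul with
    | h0 => simp only [smul_zero]
    | hadd x y hx hy => simp only [smul_add, hx, hy]
    | ht x y =>
      rw [op_smul_tmul, op_smul_tmul, base_smul_tmul, smul_assoc]
      exact (TensorProduct.smul_tmul c x (r • y)).symm

end

end ProjBimodule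

/-- The finitistic dimension of `R`: the supremum of the projective dimensions of the finitely
generated right `R`-modules of finite projective dimension (the zero module has projective
dimension `⊥`). -/
noncomputable def findim (R : Type u) [Ring R] : WithBot ℕ∞ :=
  ⨆ (M : ModuleCat.{u} Rᵐᵒᵖ) (_ : Module.Finite Rᵐᵒᵖ M) (_ : projectiveDimension M ≠ ⊤),
    projectiveDimension M

/-! ### Arrow removal and trivial extensions -/

section TrivialExtension

variable {k : Type w} {V : Type u} [Quiver.{v} V] [Field k] [Fintype V]

/-- The trivial extension `Γ ⋉ (Γe ⊗ₖ fΓ)`, where `Γ = (kQ/I)/⟨a⟩` for the arrow `a`, and `e` and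
`f` are the trivial paths at its start and its end. -/
abbrev RemovalTrivExt (I : TwoSidedIdeal (PathAlgebra k V)) (a : QArrow V) : Type (max u v w) :=
  TrivSqZeroExt (ArrowRemoval I {a})
    (ProjBimodule k (ArrowRemoval.cls I {a} (PathAlgebra.vertex k a.1))
      (ArrowRemoval.cls I {a} (PathAlgebra.vertex k a.2.1)))

/-- The isomorphism `φ : kQ/I ≃ Γ ⋉ (Γe ⊗ₖ fΓ)` is the identity on `Γ`: it sends the class of every
path `p` that does not run through `a` to `(p, 0)`. -/
def IsIdentityOnRemoval (I : TwoSidedIdeal (PathAlgebra k V)) (a : QArrow V)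
    (φ : QuiverAlgebra I ≃ₐ[k] RemovalTrivExt I a) : Prop :=
  ∀ p : QPath V, ¬ p.Contains a →
    φ (QuiverAlgebra.cls I (PathAlgebra.path k p)) =
      TrivSqZeroExt.inl (ArrowRemoval.cls I {a} (PathAlgebra.path k p))

end TrivialExtension

/-!
Everything rests on one observation. If `I` is generated by elements in which no arrow of `A`
occurs, then `Λ = kQ/I` arises from `Γ = Λ/⟨A⟩` by freely adjoining the arrows in `A`: the
projection `Λ → Γ` has a section `σ` (`IsArrowRemoval.exists_section`), and an algebra homomorphism
`Γ → B` extends along `σ` to `Λ` with arbitrary images of the arrows in `A`, as long as these lie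
between the images of the right idempotents (`IsArrowRemoval.exists_lift`).

*One arrow `a : e → f`.* If `fΓe` contained a nonzero `w`, one could let `Γ` act on itself from the
right and make `a` act so that `w * a` fixes a nonzero vector, although `w * a` is nilpotent in `Λ`.
So `fΓe = 0`, which means `Hom(eΓ, fΓ) = 0` (`IsArrowRemoval.vertex_mul_mul_vertex`), and then the
free adjunction of `a` is `Γ ⋉ (Γe ⊗ fΓ)` (`IsArrowRemoval.exists_equiv_trivSqZeroExt`). Conversely,
given `fΓe = 0`, let `I₀` be the ideal generated by the relations of `Γ` that do not involve `a`
(`reducedIdeal`). It defines the same `Γ`, its quotient is the trivial extension, and it is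
admissible, because a power of `J` falls into the square-zero part. Hence `I₀` is the required
change of presentation; and if the isomorphism `Λ ≅ Γ ⋉ (Γe ⊗ fΓ)` is the identity on `Γ`, then
`I₀ ≤ I`, and comparing dimensions gives `I₀ = I`. Admissible ideals are finitely generated, so a
generating set avoiding `a` can be thinned out to a minimal one.

*Finitistic dimensions.* The situation is axiomatized by `FreeArrowExtension`, for left modules and
hence applied to the opposite algebras. Let `R` be obtained from `G` by freely adjoining arrows such
that no element of `G` leads from a target back to a source. The induced module `R ⊗_G X` is, over
`G`, the direct sum of `X` and of the modules `G (tgt i) ⊗ₖ (src i) X`, so induction is exact, and it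
preserves projectivity. For an `R`-module `N`, the kernel of `R ⊗_G N → N` is a direct sum of copies
of the modules `G (tgt i) = R (tgt i)`, hence projective. This gives `pd_R N ≤ max (pd_G N) 1`
(`Compatible.hasProjectiveDimensionLT_add_two`). As projective `R`-modules are projective over `G`,
also `pd_G N ≤ pd_R N` (`Compatible.hasProjectiveDimensionLT_restrict`). Applying these inequalities
to the restriction of a `Λ`-module, and to a `Γ`-module viewed as a `Λ`-module, compares the two
finitistic dimensions.
-/

/-! ### The universal property of the path algebra -/

namespace PathAlgebra

variable {k : Type w} {V : Type u} [Quiver.{v} V] [Field k]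

theorem vertex_mul_self (i : V) : vertex k i * vertex k i = vertex k i := by
  simp [vertex, path_mul_path, pathMul]

theorem vertex_mul_vertex_of_ne {i j : V} (h : i ≠ j) : vertex k i * vertex k j = 0 := by
  simp [vertex, path_mul_path, pathMul, h]

theorem vertex_mul_arrow (a : QArrow V) : vertex k a.1 * arrow k a = arrow k a := by
  simp [vertex, arrow, path_mul_path, pathMul, Quiver.Hom.toPath]

theorem arrow_mul_vertex (a : QArrow V) : arrow k a * vertex k a.2.1 = arrow k a := by
  simp [vertex, arrow, path_mul_path, pathMul]

theorem path_cons {i j l : V} (p : Quiver.Path i j) (b : j ⟶ l) :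
    path k ⟨i, l, p.cons b⟩ = path k ⟨i, j, p⟩ * arrow k ⟨j, l, b⟩ := by
  simp [arrow, path_mul_path, pathMul, Quiver.Hom.toPath]

variable [Fintype V]

/-- Two algebra homomorphisms on `kQ` agree once they agree on trivial paths and on arrows. -/
theorem algHom_ext {B : Type*} [Ring B] [Algebra k B] {θ θ' : PathAlgebra k V →ₐ[k] B}
    (hv : ∀ i, θ (vertex k i) = θ' (vertex k i)) (ha : ∀ a, θ (arrow k a) = θ' (arrow k a)) :
    θ = θ' := by
  ext x
  induction x using induction_path with
  | h0 => simp
  | hadd y z hy hz => simp [hy, hz]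
  | hp c p =>
    obtain ⟨i, j, p⟩ := p
    rw [map_smul, map_smul]
    congr 1
    induction p with
    | nil => exact hv i
    | cons p b ih => rw [path_cons, map_mul, map_mul, ih, ha]

/-- The value on a path of the multiplicative map with prescribed values `E` at the trivial paths
and `F` at the arrows. -/
def liftPath {B : Type*} [Mul B] (E : V → B) (F : QArrow V → B) (i : V) :
    ∀ {j : V}, Quiver.Path i j → B
  | _, .nil => E i
  | _, .cons p b => liftPath E F i p * F ⟨_, _, b⟩

section Lift

variable {B : Type*} [Ring B] [Algebra k B] (ψ : PathAlgebra k V →ₐ[k] B) {F : QArrow V → B}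

theorem vertex_mul_liftPath {i j : V}
    (p : Quiver.Path i j) :
    ψ (vertex k i) * liftPath (fun i => ψ (vertex k i)) F i p =
      liftPath (fun i => ψ (vertex k i)) F i p := by
  induction p with
  | nil => simp only [liftPath, ← map_mul, vertex_mul_self]
  | cons p b ih => simp only [liftPath, ← mul_assoc, ih]

theorem liftPath_mul_vertex (hr : ∀ a, F a * ψ (vertex k a.2.1) = F a) {i j : V}
    (p : Quiver.Path i j) :
    liftPath (fun i => ψ (vertex k i)) F i p * ψ (vertex k j) =
      liftPath (fun i => ψ (vertex k i)) F i p := by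
  cases p with
  | nil => simp only [liftPath, ← map_mul, vertex_mul_self]
  | cons p b => simp only [liftPath, mul_assoc, hr]

theorem liftPath_comp (hr : ∀ a, F a * ψ (vertex k a.2.1) = F a) {i j l : V}
    (p : Quiver.Path i j) (q : Quiver.Path j l) :
    liftPath (fun i => ψ (vertex k i)) F i (p.comp q) =
      liftPath (fun i => ψ (vertex k i)) F i p * liftPath (fun i => ψ (vertex k i)) F j q := by
  induction q with
  | nil => simp only [liftPath, Quiver.Path.comp_nil, liftPath_mul_vertex ψ hr]
  | cons q b ih => simp only [liftPath, Quiver.Path.comp_cons, ih, mul_assoc]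

/-- The images of the arrows under an algebra homomorphism on `kQ` can be changed at will, as long
as they stay between the images of the same trivial paths. -/
theorem exists_algHom (hl : ∀ a, ψ (vertex k a.1) * F a = F a)
    (hr : ∀ a, F a * ψ (vertex k a.2.1) = F a) :
    ∃ θ : PathAlgebra k V →ₐ[k] B,
      (∀ i, θ (vertex k i) = ψ (vertex k i)) ∧ ∀ a, θ (arrow k a) = F a := by
  let P : QPath V → B := fun p => liftPath (fun i => ψ (vertex k i)) F p.1 p.2.2
  let T : PathAlgebra k V →ₗ[k] B := (Finsupp.linearCombination k P : (QPath V →₀ k) →ₗ[k] B)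
  have hT : ∀ p, T (path k p) = P p := fun p => by
    simp only [T, path]
    erw [Finsupp.linearCombination_single, one_smul]
  have hPP : ∀ p q, T (path k p * path k q) = P p * P q := by
    rintro ⟨i, j, p⟩ ⟨i', j', q⟩
    by_cases h : j = i'
    · subst h
      simp only [path_mul_path, pathMul, dif_pos, hT, P]
      exact liftPath_comp ψ hr p q
    · simp only [path_mul_path, pathMul, h, dif_neg, not_false_eq_true, map_zero, P]
      rw [← liftPath_mul_vertex ψ hr p, ← vertex_mul_liftPath ψ q, mul_assoc,
        ← mul_assoc (ψ _) (ψ _), ← map_mul, vertex_mul_vertex_of_ne h, map_zero, zero_mul, mul_zero]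
  have hv : ∀ i, T (vertex k i) = ψ (vertex k i) := fun i => by simp only [vertex, hT, P, liftPath]
  refine ⟨AlgHom.ofLinearMap T ?_ fun x y => ?_, hv, fun a => ?_⟩
  · simp only [one_def, map_sum, hv]
    rw [← map_sum, ← one_def, map_one]
  · induction x using induction_path with
    | h0 => simp
    | hadd x₁ x₂ h₁ h₂ => simp only [add_mul, map_add, h₁, h₂]
    | hp c p =>
      induction y using induction_path with
      | h0 => simp
      | hadd x₁ x₂ h₁ h₂ => simp only [mul_add, map_add, h₁, h₂]
      | hp d q => simp only [smul_mul_assoc, mul_smul_comm, map_smul, hPP, hT]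
  · obtain ⟨i, j, a⟩ := a
    change T (path k _) = _
    rw [hT]
    exact hl ⟨i, j, a⟩

end Lift

/-! ### Deleting arrows -/

theorem exists_deletion (k : Type w) [Field k] (A : Set (QArrow V)) :
    ∃ D : PathAlgebra k V →ₐ[k] PathAlgebra k V, (∀ i, D (vertex k i) = vertex k i) ∧
      (∀ a ∈ A, D (arrow k a) = 0) ∧ ∀ a ∉ A, D (arrow k a) = arrow k a := by
  classical
  obtain ⟨D, hv, ha⟩ := exists_algHom (AlgHom.id k (PathAlgebra k V))
    (F := fun a => if a ∈ A then 0 else arrow k a)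
    (fun a => by split_ifs <;> simp [vertex_mul_arrow])
    (fun a => by split_ifs <;> simp [arrow_mul_vertex])
  exact ⟨D, hv, fun a h => by rw [ha, if_pos h], fun a h => by rw [ha, if_neg h]⟩

/-- The endomorphism of `kQ` that sends the arrows in `A` to zero and fixes the other arrows and the
trivial paths. Its image is the path algebra of the quiver with the arrows in `A` removed. -/
noncomputable def deletion (k : Type w) [Field k] (A : Set (QArrow V)) :
    PathAlgebra k V →ₐ[k] PathAlgebra k V :=
  (exists_deletion k A).choose

variable {A : Set (QArrow V)}

theorem deletion_vertex (i : V) : deletion k A (vertex k i) = vertex k i :=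
  (exists_deletion k A).choose_spec.1 i

theorem deletion_arrow_of_mem {a : QArrow V} (h : a ∈ A) : deletion k A (arrow k a) = 0 :=
  (exists_deletion k A).choose_spec.2.1 a h

theorem deletion_arrow_of_notMem {a : QArrow V} (h : a ∉ A) :
    deletion k A (arrow k a) = arrow k a :=
  (exists_deletion k A).choose_spec.2.2 a h

theorem deletion_deletion (x : PathAlgebra k V) :
    deletion k A (deletion k A x) = deletion k A x := by
  have : (deletion k A).comp (deletion k A) = deletion k A :=
    algHom_ext (fun i => by simp [deletion_vertex]) fun a => by
      by_cases h : a ∈ A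
      · simp [deletion_arrow_of_mem h]
      · simp [deletion_arrow_of_notMem h]
  exact DFunLike.congr_fun this x

/-- Two algebra homomorphisms on `kQ` that agree outside the arrows in `A` agree on every element
in which no arrow of `A` occurs. -/
theorem eq_on_deletion_fixed {B : Type*} [Ring B] [Algebra k B] {θ θ' : PathAlgebra k V →ₐ[k] B}
    (hv : ∀ i, θ (vertex k i) = θ' (vertex k i))
    (ha : ∀ a ∉ A, θ (arrow k a) = θ' (arrow k a)) {x : PathAlgebra k V}
    (hx : deletion k A x = x) : θ x = θ' x := by
  have : θ.comp (deletion k A) = θ'.comp (deletion k A) :=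
    algHom_ext (fun i => by simp [deletion_vertex, hv]) fun a => by
      by_cases h : a ∈ A
      · simp [deletion_arrow_of_mem h]
      · simp [deletion_arrow_of_notMem h, ha a h]
  rw [← hx]
  exact DFunLike.congr_fun this x

theorem sub_deletion_mem (x : PathAlgebra k V) :
    x - deletion k A x ∈ TwoSidedIdeal.span (arrow k '' A) := by
  induction x using induction_path with
  | h0 => simp
  | hadd y z hy hz =>
    rw [map_add, add_sub_add_comm]
    exact TwoSidedIdeal.add_mem _ hy hz
  | hp c p =>
    obtain ⟨i, j, p⟩ := p
    rw [map_smul, ← smul_sub, ← one_mul (path k _ - _), ← smul_mul_assoc]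
    refine TwoSidedIdeal.mul_mem_left _ _ _ ?_
    induction p with
    | nil =>
      have := deletion_vertex (k := k) (A := A) i
      rw [vertex] at this
      rw [this, sub_self]
      exact TwoSidedIdeal.zero_mem _
    | @cons j l p b ih =>
      have h : ∀ x y z w : PathAlgebra k V, x * y - z * w = (x - z) * y + z * (y - w) := by
        intros; noncomm_ring
      rw [path_cons, map_mul, h]
      refine TwoSidedIdeal.add_mem _ (TwoSidedIdeal.mul_mem_right _ _ _ ih)
        (TwoSidedIdeal.mul_mem_left _ _ _ ?_)
      by_cases hb : (⟨j, l, b⟩ : QArrow V) ∈ A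
      · rw [deletion_arrow_of_mem hb, sub_zero]
        exact TwoSidedIdeal.subset_span ⟨_, hb, rfl⟩
      · rw [deletion_arrow_of_notMem hb, sub_self]
        exact TwoSidedIdeal.zero_mem _

theorem deletion_eq_zero_of_mem {x : PathAlgebra k V}
    (hx : x ∈ TwoSidedIdeal.span (arrow k '' A)) : deletion k A x = 0 := by
  induction hx using TwoSidedIdeal.span_induction with
  | mem x h =>
    obtain ⟨a, ha, rfl⟩ := h
    exact deletion_arrow_of_mem ha
  | zero => exact map_zero _
  | add x y _ _ hx hy => rw [map_add, hx, hy, add_zero]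
  | neg x _ hx => rw [map_neg, hx, neg_zero]
  | left_absorb a x _ hx => rw [map_mul, hx, mul_zero]
  | right_absorb b x _ hx => rw [map_mul, hx, zero_mul]

end PathAlgebra

theorem QPath.not_contains_nil {V : Type u} [Quiver.{v} V] (i : V) (a : QArrow V) :
    ¬ QPath.Contains ⟨i, i, .nil⟩ a := by
  rintro ⟨q, r, h⟩
  have := congrArg Quiver.Path.length h
  simp at this
  omega

theorem QPath.contains_cons {V : Type u} [Quiver.{v} V] {i j l : V} (p : Quiver.Path i j)
    (b : j ⟶ l) (a : QArrow V) :
    QPath.Contains ⟨i, l, p.cons b⟩ a ↔ QPath.Contains ⟨i, j, p⟩ a ∨ a = ⟨j, l, b⟩ := by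
  constructor
  · rintro ⟨q, r, h⟩
    dsimp only at q r h
    cases r with
    | nil =>
      right
      obtain ⟨s, t, a⟩ := a
      simp only [Quiver.Path.comp_nil] at h
      cases h
      rfl
    | cons r c =>
      left
      simp only [Quiver.Path.comp_cons] at h
      cases h
      exact ⟨q, r, rfl⟩
  · rintro (⟨q, r, h⟩ | rfl)
    · exact ⟨q, r.cons b, congrArg (fun p => Quiver.Path.cons p b) h⟩
    · exact ⟨p, .nil, rfl⟩

namespace PathAlgebra

variable {k : Type w} {V : Type u} [Quiver.{v} V] [Field k] [Fintype V] {A : Set (QArrow V)}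

theorem deletion_path_of_not_contains (p : QPath V) (h : ∀ a ∈ A, ¬ p.Contains a) :
    deletion k A (path k p) = path k p := by
  obtain ⟨i, j, p⟩ := p
  induction p with
  | nil => exact deletion_vertex i
  | @cons j l p b ih =>
    simp only [QPath.contains_cons, not_or] at h
    rw [path_cons, map_mul, ih fun a ha => (h a ha).1,
      deletion_arrow_of_notMem fun hb => (h _ hb).2 rfl]

theorem deletion_path_of_contains (p : QPath V) (h : ∃ a ∈ A, p.Contains a) :
    deletion k A (path k p) = 0 := by
  obtain ⟨i, j, p⟩ := p
  obtain ⟨a, ha, h⟩ := h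
  induction p with
  | nil => exact absurd h (QPath.not_contains_nil i a)
  | @cons j l p b ih =>
    rw [path_cons, map_mul]
    rcases (QPath.contains_cons p b a).1 h with h | rfl
    · rw [ih h, zero_mul]
    · rw [deletion_arrow_of_mem ha, mul_zero]

theorem coeffs_deletion_of_contains (x : PathAlgebra k V) {p : QPath V}
    (hp : ∃ a ∈ A, p.Contains a) : (deletion k A x).coeffs p = 0 := by
  classical
  induction x using induction_path with
  | h0 => rw [map_zero]; rfl
  | hadd y z hy hz =>
    rw [map_add]
    change (deletion k A y).coeffs p + (deletion k A z).coeffs p = 0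
    rw [hy, hz, add_zero]
  | hp c q =>
    rw [map_smul]
    change c • (deletion k A (path k q)).coeffs p = 0
    by_cases hq : ∃ a ∈ A, q.Contains a
    · rw [deletion_path_of_contains q hq]
      exact smul_zero c
    · rw [deletion_path_of_not_contains q fun a ha hqa => hq ⟨a, ha, hqa⟩]
      have : p ≠ q := by rintro rfl; exact hq hp
      change c • (Finsupp.single q 1 : QPath V →₀ k) p = 0
      rw [Finsupp.single_eq_of_ne this, smul_zero]

/-- No arrow of `A` occurs in `x` if and only if `x` lies in the path algebra of the quiver with the
arrows in `A` removed. -/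
theorem deletion_eq_self_iff (x : PathAlgebra k V) :
    deletion k A x = x ↔ ∀ a ∈ A, ¬ x.Involves a := by
  constructor
  · rintro h a ha ⟨p, hp, hpa⟩
    rw [← h, Finsupp.mem_support_iff] at hp
    exact hp (coeffs_deletion_of_contains x ⟨a, ha, hpa⟩)
  · intro h
    have hx : x = ∑ p ∈ x.coeffs.support, x.coeffs p • path k p := by
      have := (Finsupp.sum_single x.coeffs).symm
      refine this.trans (Finset.sum_congr rfl fun p _ => ?_)
      change Finsupp.single p (x.coeffs p) = x.coeffs p • (Finsupp.single p (1 : k))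
      rw [Finsupp.smul_single, smul_eq_mul, mul_one]
    have hD : deletion k A (∑ p ∈ x.coeffs.support, x.coeffs p • path k p) =
        ∑ p ∈ x.coeffs.support, x.coeffs p • path k p := by
      rw [map_sum]
      refine Finset.sum_congr rfl fun p hp => ?_
      rw [map_smul, deletion_path_of_not_contains p fun a ha hpa => h a ha ⟨p, hp, hpa⟩]
    rwa [← hx] at hD

end PathAlgebra

/-! ### Powers of the arrow ideal -/

section ArrowIdeal

open PathAlgebra

variable {k : Type w} {V : Type u} [Quiver.{v} V] [Field k] [Fintype V]

theorem arrow_mem_arrowIdeal (a : QArrow V) : arrow k a ∈ (arrowIdeal k V).asIdeal :=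
  TwoSidedIdeal.mem_asIdeal.2 (TwoSidedIdeal.subset_span ⟨a, rfl⟩)

/-- The arrows generate the arrow ideal already as a left ideal, since every nontrivial path ends
with an arrow. -/
theorem arrowIdeal_eq_span :
    (arrowIdeal k V).asIdeal = Ideal.span (Set.range (arrow (V := V) k)) := by
  have hright : ∀ (a : QArrow V) (y : PathAlgebra k V),
      arrow k a * y ∈ Ideal.span (Set.range (arrow (V := V) k)) := by
    intro a y
    induction y using induction_path with
    | h0 => simp
    | hadd y z hy hz => rw [mul_add]; exact add_mem hy hz
    | hp c p =>
      obtain ⟨i, j, p⟩ := p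
      rw [mul_smul_comm, ← smul_mul_assoc]
      cases p with
      | nil =>
        by_cases h : a.2.1 = i
        · subst h
          rw [smul_mul_assoc, ← vertex, arrow_mul_vertex, ← one_mul (arrow k a), ← smul_mul_assoc]
          exact Ideal.mul_mem_left _ _ (Ideal.subset_span ⟨a, rfl⟩)
        · rw [smul_mul_assoc, ← arrow_mul_vertex a, mul_assoc, ← vertex,
            vertex_mul_vertex_of_ne h, mul_zero, smul_zero]
          exact zero_mem _
      | cons p b =>
        rw [path_cons, ← mul_assoc]
        exact Ideal.mul_mem_left _ _ (Ideal.subset_span ⟨_, rfl⟩)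
  have htwo : (Ideal.span (Set.range (arrow (V := V) k))).IsTwoSided := by
    refine ⟨fun {x} y hx => ?_⟩
    induction hx using Submodule.span_induction with
    | mem x h =>
      obtain ⟨a, rfl⟩ := h
      exact hright a y
    | zero => simp
    | add x z _ _ hx hz => rw [add_mul]; exact add_mem hx hz
    | smul c x _ hx =>
      rw [smul_eq_mul, mul_assoc]
      exact Ideal.mul_mem_left _ _ hx
  refine le_antisymm (fun x hx => ?_) (Ideal.span_le.2 ?_)
  · have : arrowIdeal k V ≤ (Ideal.span (Set.range (arrow (V := V) k))).toTwoSided :=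
      TwoSidedIdeal.span_le.2 fun y hy => by
        rw [SetLike.mem_coe, Ideal.mem_toTwoSided]
        exact Ideal.subset_span hy
    exact Ideal.mem_toTwoSided.1 (this (TwoSidedIdeal.mem_asIdeal.1 hx))
  · rintro _ ⟨a, rfl⟩
    exact arrow_mem_arrowIdeal a

theorem deletion_mem_arrowIdeal_sq {A : Set (QArrow V)} {x : PathAlgebra k V}
    (hx : x ∈ (arrowIdeal k V).asIdeal ^ 2) :
    deletion k A x ∈ (arrowIdeal k V).asIdeal ^ 2 := by
  have h1 : ∀ y ∈ (arrowIdeal k V).asIdeal, deletion k A y ∈ (arrowIdeal k V).asIdeal := by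
    intro y hy
    have hle : arrowIdeal k V ≤ (arrowIdeal k V).comap (deletion k A) := by
      refine TwoSidedIdeal.span_le.2 ?_
      rintro _ ⟨a, rfl⟩
      rw [SetLike.mem_coe, TwoSidedIdeal.mem_comap]
      by_cases h : a ∈ A
      · rw [deletion_arrow_of_mem h]
        exact TwoSidedIdeal.zero_mem _
      · rw [deletion_arrow_of_notMem h]
        exact TwoSidedIdeal.subset_span ⟨a, rfl⟩
    exact TwoSidedIdeal.mem_asIdeal.2
      ((TwoSidedIdeal.mem_comap _).1 (hle (TwoSidedIdeal.mem_asIdeal.1 hy)))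
  rw [Submodule.pow_succ, Submodule.pow_one] at hx ⊢
  induction hx using Submodule.smul_induction_on' with
  | smul r hr s hs =>
    rw [smul_eq_mul, map_mul]
    exact Ideal.mul_mem_mul (h1 r hr) (h1 s hs)
  | add x _ y _ hx hy => rw [map_add]; exact add_mem hx hy

variable [∀ i j : V, Finite (i ⟶ j)]

instance QArrow.finite : Finite (QArrow V) :=
  inferInstanceAs (Finite (Σ i j : V, (i ⟶ j)))

open scoped Pointwise in
theorem arrowIdeal_pow_fg (n : ℕ) : ((arrowIdeal k V).asIdeal ^ n).FG := by
  suffices h : ∃ s : Set (PathAlgebra k V), s.Finite ∧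
      (arrowIdeal k V).asIdeal ^ n = Ideal.span s by
    obtain ⟨s, hs, h⟩ := h
    exact h ▸ Submodule.fg_span hs
  induction n with
  | zero =>
    refine ⟨{1}, Set.finite_singleton 1, ?_⟩
    rw [Submodule.pow_zero, Ideal.one_eq_top, Ideal.span_singleton_one]
  | succ n ih =>
    obtain ⟨s, hs, h⟩ := ih
    refine ⟨s * Set.range (arrow k), hs.mul (Set.finite_range _), ?_⟩
    have : (Ideal.span s).IsTwoSided := h ▸ inferInstance
    rw [Ideal.IsTwoSided.pow_add, Submodule.pow_one, ← Ideal.span_mul_span', ← h,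
      ← arrowIdeal_eq_span]

/-- Up to elements of `J ^ n`, the path algebra is spanned by finitely many elements. -/
theorem exists_fg_sup_arrowIdeal_pow (n : ℕ) :
    ∃ T : Submodule k (PathAlgebra k V), T.FG ∧
      T ⊔ ((arrowIdeal k V).asIdeal ^ n).restrictScalars k = ⊤ := by
  -- `T` is spanned by the paths of length at most one, so that `T ^ n` contains the shorter paths.
  let T : Submodule k (PathAlgebra k V) :=
    Submodule.span k (Set.range (vertex k) ∪ Set.range (arrow k))
  have hT : T.FG := Submodule.fg_span ((Set.finite_range _).union (Set.finite_range _))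
  have hv : ∀ i, vertex k i ∈ T := fun i => Submodule.subset_span (Or.inl ⟨i, rfl⟩)
  have ha : ∀ a, arrow k a ∈ T := fun a => Submodule.subset_span (Or.inr ⟨a, rfl⟩)
  have h1 : (1 : PathAlgebra k V) ∈ T := by
    rw [one_def]
    exact Submodule.sum_mem _ fun i _ => hv i
  have hmono : ∀ m, T ^ m ≤ T ^ (m + 1) := fun m x hx => by
    rw [pow_succ, ← mul_one x]
    exact Submodule.mul_mem_mul hx h1
  have hlen : ∀ {i j : V} (p : Quiver.Path i j),
      path k ⟨i, j, p⟩ ∈ T ^ (p.length + 1) ∧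
        path k ⟨i, j, p⟩ ∈ (arrowIdeal k V).asIdeal ^ p.length := by
    intro i j p
    induction p with
    | nil =>
      refine ⟨by rw [Quiver.Path.length_nil, zero_add, pow_one]; exact hv i, ?_⟩
      rw [Quiver.Path.length_nil, Submodule.pow_zero, Ideal.one_eq_top]
      trivial
    | cons p b ih =>
      rw [path_cons, Quiver.Path.length_cons]
      constructor
      · rw [pow_succ]
        exact Submodule.mul_mem_mul ih.1 (ha _)
      · rw [Ideal.IsTwoSided.pow_add, Submodule.pow_one]
        exact Ideal.mul_mem_mul ih.2 (arrow_mem_arrowIdeal _)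
  refine ⟨T ^ n, hT.pow n, eq_top_iff.2 fun x _ => ?_⟩
  induction x using induction_path with
  | h0 => exact zero_mem _
  | hadd y z hy hz => exact add_mem (hy trivial) (hz trivial)
  | hp c p =>
    refine Submodule.smul_mem _ _ ?_
    obtain ⟨i, j, p⟩ := p
    rcases le_or_gt n p.length with h | h
    · refine Submodule.mem_sup_right ?_
      obtain ⟨d, hd⟩ := Nat.exists_eq_add_of_le h
      have := (hlen p).2
      rw [hd, Ideal.IsTwoSided.pow_add] at this
      exact Ideal.mul_le_left this
    · exact Submodule.mem_sup_left (monotone_nat_of_le_succ hmono h (hlen p).1)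

variable {I : TwoSidedIdeal (PathAlgebra k V)}

theorem finite_of_arrowIdeal_pow_le {n : ℕ} (h : (arrowIdeal k V).asIdeal ^ n ≤ I.asIdeal) :
    Module.Finite k (QuiverAlgebra I) := by
  obtain ⟨T, hT, hsup⟩ := exists_fg_sup_arrowIdeal_pow (k := k) (V := V) n
  let q : PathAlgebra k V →ₗ[k] QuiverAlgebra I := (Ideal.Quotient.mkₐ k I.asIdeal).toLinearMap
  refine ⟨?_⟩
  have : T.map q = ⊤ := by
    refine eq_top_iff.2 fun y _ => ?_
    obtain ⟨x, rfl⟩ := Ideal.Quotient.mk_surjective y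
    obtain ⟨t, ht, z, hz, rfl⟩ := Submodule.mem_sup.1 (hsup ▸ Submodule.mem_top : x ∈ _)
    refine ⟨t, ht, ?_⟩
    rw [map_add, Ideal.Quotient.eq_zero_iff_mem.2 (h hz), add_zero]
    rfl
  exact this ▸ hT.map q

theorem asIdeal_fg_of_arrowIdeal_pow_le {n : ℕ}
    (h : (arrowIdeal k V).asIdeal ^ n ≤ I.asIdeal) : I.asIdeal.FG := by
  let J := (arrowIdeal k V).asIdeal ^ n
  have hJ : (I.asIdeal ⊓ LinearMap.ker J.mkQ).FG := by
    rw [Submodule.ker_mkQ, inf_eq_right.2 h]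
    exact arrowIdeal_pow_fg n
  refine Submodule.fg_of_fg_map_of_fg_inf_ker J.mkQ ?_ hJ
  have hJ2 : J = J.toTwoSided.asIdeal := (Ideal.asIdeal_toTwoSided J).symm
  have hfin : Module.Finite k (PathAlgebra k V ⧸ J) := by
    rw [hJ2]
    exact finite_of_arrowIdeal_pow_le (n := n) hJ2.le
  have : IsNoetherian (PathAlgebra k V) (PathAlgebra k V ⧸ J) :=
    isNoetherian_of_tower k inferInstance
  exact IsNoetherian.noetherian _

end ArrowIdeal

/-! ### Minimal generating sets -/

namespace TwoSidedIdeal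

variable {R : Type*} [Ring R]

theorem exists_finite_subset_of_mem_span {S : Set R} {x : R} (hx : x ∈ span S) :
    ∃ T ⊆ S, T.Finite ∧ x ∈ span T := by
  induction hx using span_induction with
  | mem x h => exact ⟨{x}, by simpa using h, Set.finite_singleton x, subset_span rfl⟩
  | zero => exact ⟨∅, Set.empty_subset _, Set.finite_empty, zero_mem _⟩
  | add x y _ _ hx hy =>
    obtain ⟨T, hTS, hT, hxT⟩ := hx
    obtain ⟨U, hUS, hU, hyU⟩ := hy
    exact ⟨T ∪ U, Set.union_subset hTS hUS, hT.union hU,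
      add_mem _ (span_mono Set.subset_union_left hxT) (span_mono Set.subset_union_right hyU)⟩
  | neg x _ hx =>
    obtain ⟨T, hTS, hT, hxT⟩ := hx
    exact ⟨T, hTS, hT, neg_mem _ hxT⟩
  | left_absorb a x _ hx =>
    obtain ⟨T, hTS, hT, hxT⟩ := hx
    exact ⟨T, hTS, hT, mul_mem_left _ _ _ hxT⟩
  | right_absorb a x _ hx =>
    obtain ⟨T, hTS, hT, hxT⟩ := hx
    exact ⟨T, hTS, hT, mul_mem_right _ _ _ hxT⟩

theorem exists_finite_subset_span_eq {I : TwoSidedIdeal R} (hI : I.asIdeal.FG) {S : Set R}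
    (hS : span S = I) : ∃ T ⊆ S, T.Finite ∧ span T = I := by
  obtain ⟨g, hg⟩ := hI
  have hgS : ∀ x ∈ g, ∃ T ⊆ S, T.Finite ∧ x ∈ span T := fun x hx =>
    exists_finite_subset_of_mem_span <| by
      rw [hS, ← mem_asIdeal, ← hg]
      exact Submodule.subset_span hx
  choose! T hTS hT hxT using hgS
  refine ⟨⋃ x ∈ g, T x, Set.iUnion₂_subset hTS, g.finite_toSet.biUnion hT, le_antisymm ?_ ?_⟩
  · exact hS ▸ span_mono (Set.iUnion₂_subset hTS)
  · intro x hx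
    have : I.asIdeal ≤ (span (⋃ x ∈ g, T x)).asIdeal := by
      rw [← hg]
      exact Submodule.span_le.2 fun y hy =>
        span_mono (Set.subset_biUnion_of_mem (u := T) hy) (hxT y hy)
    exact this hx

/-- A generating set of a finitely generated two-sided ideal contains a minimal one. -/
theorem exists_isMinimalGeneratingSet_subset {I : TwoSidedIdeal R} (hI : I.asIdeal.FG) {S : Set R}
    (hS : span S = I) : ∃ T ⊆ S, IsMinimalGeneratingSet I T := by
  obtain ⟨T, hTS, hT, hspan⟩ := exists_finite_subset_span_eq hI hS
  have hfin : {U : Set R | U ⊆ T ∧ span U = I}.Finite :=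
    hT.finite_subsets.subset fun U hU => hU.1
  obtain ⟨U, hU⟩ := hfin.exists_minimal ⟨T, subset_rfl, hspan⟩
  exact ⟨U, hU.prop.1.trans hTS, hU.prop.2, fun W hW hWI =>
    hW.not_subset (hU.le_of_le ⟨hW.subset.trans hU.prop.1, hWI⟩ hW.subset)⟩

end TwoSidedIdeal

section Avoids

open PathAlgebra

variable {k : Type w} {V : Type u} [Quiver.{v} V] [Field k] [Fintype V]
  {I : TwoSidedIdeal (PathAlgebra k V)} {A : Set (QArrow V)}

theorem AvoidsArrows.exists_span_eq (h : AvoidsArrows I A) :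
    ∃ S, TwoSidedIdeal.span S = I ∧ ∀ x ∈ S, deletion k A x = x := by
  obtain ⟨S, hS, hA⟩ := h
  exact ⟨S, hS.1, fun x hx => (deletion_eq_self_iff x).2 (hA x hx)⟩

theorem avoidsArrows_of_span_eq [∀ i j : V, Finite (i ⟶ j)] (hI : IsAdmissible I)
    {S : Set (PathAlgebra k V)} (hS : TwoSidedIdeal.span S = I)
    (hA : ∀ x ∈ S, deletion k A x = x) : AvoidsArrows I A := by
  obtain ⟨m, -, hm⟩ := hI.2
  obtain ⟨T, hTS, hT⟩ :=
    TwoSidedIdeal.exists_isMinimalGeneratingSet_subset (asIdeal_fg_of_arrowIdeal_pow_le hm) hS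
  exact ⟨T, hT, fun x hx => (deletion_eq_self_iff x).1 (hA x (hTS hx))⟩

end Avoids

/-! ### Algebras given by relations without the removed arrows -/

theorem AlgHom.exists_factor {k A B C : Type*} [CommRing k] [Ring A] [Ring B] [Ring C]
    [Algebra k A] [Algebra k B] [Algebra k C] {f : A →ₐ[k] B} (hf : Function.Surjective f)
    (g : A →ₐ[k] C) (h : ∀ x, f x = 0 → g x = 0) : ∃ θ : B →ₐ[k] C, ∀ x, θ (f x) = g x := by
  refine ⟨(Ideal.Quotient.liftₐ (RingHom.ker f) g h).comp
    (Ideal.quotientKerAlgEquivOfSurjective hf).symm.toAlgHom, fun x => ?_⟩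
  have : (Ideal.quotientKerAlgEquivOfSurjective hf).symm (f x) = Ideal.Quotient.mk _ x :=
    (AlgEquiv.symm_apply_eq _).2 rfl
  change Ideal.Quotient.liftₐ (RingHom.ker f) g h
    ((Ideal.quotientKerAlgEquivOfSurjective hf).symm (f x)) = g x
  rw [this]
  rfl

open PathAlgebra

/-- The maps `q : kQ → Λ` and `π : kQ → Γ` present `Λ` as `kQ/I`, where `I` is generated by elements
in which no arrow of `A` occurs, and `Γ` as `Λ` modulo the arrows in `A`. -/
structure IsArrowRemoval {k : Type w} {V : Type u} [Quiver.{v} V] [Field k] [Fintype V]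
    (I : TwoSidedIdeal (PathAlgebra k V)) (A : Set (QArrow V)) {Λ Γ : Type*} [Ring Λ] [Algebra k Λ]
    [Ring Γ] [Algebra k Γ] (q : PathAlgebra k V →ₐ[k] Λ) (π : PathAlgebra k V →ₐ[k] Γ) : Prop where
  exists_span_eq : ∃ S, TwoSidedIdeal.span S = I ∧ ∀ x ∈ S, deletion k A x = x
  surjective_q : Function.Surjective q
  q_eq_zero_iff : ∀ x, q x = 0 ↔ x ∈ I
  surjective_pi : Function.Surjective π
  pi_eq_zero_iff : ∀ x, π x = 0 ↔ x ∈ I ⊔ TwoSidedIdeal.span (arrow k '' A)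

namespace IsArrowRemoval

variable {k : Type w} {V : Type u} [Quiver.{v} V] [Field k] [Fintype V]
  {I : TwoSidedIdeal (PathAlgebra k V)} {A : Set (QArrow V)} {Λ Γ : Type*} [Ring Λ] [Algebra k Λ]
  [Ring Γ] [Algebra k Γ] {q : PathAlgebra k V →ₐ[k] Λ} {π : PathAlgebra k V →ₐ[k] Γ}
  (h : IsArrowRemoval I A q π)

include h

theorem pi_arrow {a : QArrow V} (ha : a ∈ A) : π (arrow k a) = 0 :=
  (h.pi_eq_zero_iff _).2 ((le_sup_right : _ ≤ I ⊔ TwoSidedIdeal.span (arrow k '' A))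
    (TwoSidedIdeal.subset_span ⟨a, ha, rfl⟩))

theorem pi_deletion (x : PathAlgebra k V) : π (deletion k A x) = π x := by
  have := (h.pi_eq_zero_iff _).2
    ((le_sup_right : _ ≤ I ⊔ TwoSidedIdeal.span (arrow k '' A)) (sub_deletion_mem (A := A) x))
  rw [map_sub, sub_eq_zero] at this
  exact this.symm

/-- A homomorphism on `kQ` that agrees with one factoring through `Γ` away from the arrows in `A`
factors through `Λ`. -/
theorem map_eq_zero {B : Type*} [Ring B] [Algebra k B] (ρ : Γ →ₐ[k] B)
    (ψ : PathAlgebra k V →ₐ[k] B) (hψ : ∀ x, deletion k A x = x → ψ x = ρ (π x))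
    {x : PathAlgebra k V} (hx : q x = 0) : ψ x = 0 := by
  obtain ⟨S, hS, hSA⟩ := h.exists_span_eq
  rw [h.q_eq_zero_iff, ← hS] at hx
  have hle : TwoSidedIdeal.span S ≤ (⊥ : TwoSidedIdeal B).comap ψ := by
    refine TwoSidedIdeal.span_le.2 fun s hs => ?_
    rw [SetLike.mem_coe, TwoSidedIdeal.mem_comap, TwoSidedIdeal.mem_bot, hψ s (hSA s hs),
      (h.pi_eq_zero_iff s).2, map_zero]
    exact (le_sup_left : I ≤ _) (hS ▸ TwoSidedIdeal.subset_span hs)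
  simpa [TwoSidedIdeal.mem_comap, TwoSidedIdeal.mem_bot] using hle hx

theorem exists_proj : ∃ τ : Λ →ₐ[k] Γ, ∀ x, τ (q x) = π x :=
  AlgHom.exists_factor h.surjective_q π fun _ hx =>
    h.map_eq_zero (AlgHom.id k Γ) π (fun _ _ => rfl) hx

/-- The projection `Λ → Γ` splits: as the relations do not involve the arrows in `A`, setting these
arrows to zero is compatible with the relations. -/
theorem exists_section : ∃ σ : Γ →ₐ[k] Λ, ∀ x, σ (π x) = q (deletion k A x) := by
  refine AlgHom.exists_factor h.surjective_pi (q.comp (deletion k A)) fun x hx => ?_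
  obtain ⟨S, hS, hSA⟩ := h.exists_span_eq
  rw [h.pi_eq_zero_iff] at hx
  have hle : I ⊔ TwoSidedIdeal.span (arrow k '' A) ≤
      (⊥ : TwoSidedIdeal Λ).comap (q.comp (deletion k A)) := by
    refine sup_le (hS ▸ TwoSidedIdeal.span_le.2 fun s hs => ?_)
      (TwoSidedIdeal.span_le.2 ?_)
    · rw [SetLike.mem_coe, TwoSidedIdeal.mem_comap, TwoSidedIdeal.mem_bot, AlgHom.comp_apply,
        hSA s hs, h.q_eq_zero_iff, ← hS]
      exact TwoSidedIdeal.subset_span hs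
    · rintro _ ⟨a, ha, rfl⟩
      rw [SetLike.mem_coe, TwoSidedIdeal.mem_comap, TwoSidedIdeal.mem_bot, AlgHom.comp_apply,
        deletion_arrow_of_mem ha, map_zero]
  simpa [TwoSidedIdeal.mem_comap, TwoSidedIdeal.mem_bot] using hle hx

variable {σ : Γ →ₐ[k] Λ} (hσ : ∀ x, σ (π x) = q (deletion k A x))

include hσ in
/-- The algebra `Λ` arises from `Γ` by freely adjoining the arrows in `A`. -/
theorem exists_lift {B : Type*} [Ring B] [Algebra k B] (ρ : Γ →ₐ[k] B) (b : QArrow V → B)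
    (hl : ∀ a ∈ A, ρ (π (vertex k a.1)) * b a = b a)
    (hr : ∀ a ∈ A, b a * ρ (π (vertex k a.2.1)) = b a) :
    ∃ θ : Λ →ₐ[k] B, (∀ g, θ (σ g) = ρ g) ∧ ∀ a ∈ A, θ (q (arrow k a)) = b a := by
  classical
  obtain ⟨ψ, hv, ha⟩ := exists_algHom (ρ.comp π)
    (F := fun a => if a ∈ A then b a else ρ (π (arrow k a)))
    (fun a => by
      split_ifs with h
      · exact hl a h
      · rw [AlgHom.comp_apply, ← map_mul, ← map_mul, vertex_mul_arrow])
    (fun a => by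
      split_ifs with h
      · exact hr a h
      · rw [AlgHom.comp_apply, ← map_mul, ← map_mul, arrow_mul_vertex])
  have hψ : ∀ x, deletion k A x = x → ψ x = ρ (π x) := fun x hx =>
    eq_on_deletion_fixed (θ' := ρ.comp π) hv (fun a h => by rw [ha, if_neg h]; rfl) hx
  obtain ⟨θ, hθ⟩ := AlgHom.exists_factor h.surjective_q ψ fun x hx => h.map_eq_zero ρ ψ hψ hx
  refine ⟨θ, fun g => ?_, fun a haA => ?_⟩
  · obtain ⟨x, rfl⟩ := h.surjective_pi g
    rw [hσ, hθ, hψ _ (deletion_deletion x), h.pi_deletion]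
  · rw [hθ, ha, if_pos haA]

include hσ in
theorem algHom_ext {B : Type*} [Ring B] [Algebra k B] {θ θ' : Λ →ₐ[k] B}
    (hg : ∀ g, θ (σ g) = θ' (σ g)) (ha : ∀ a ∈ A, θ (q (arrow k a)) = θ' (q (arrow k a))) :
    θ = θ' := by
  have : θ.comp q = θ'.comp q := by
    refine PathAlgebra.algHom_ext (fun i => ?_) fun a => ?_
    · have := hg (π (vertex k i))
      rwa [hσ, deletion_vertex] at this
    · by_cases haA : a ∈ A
      · exact ha a haA
      · have := hg (π (arrow k a))
        rwa [hσ, deletion_arrow_of_notMem haA] at this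
  ext y
  obtain ⟨x, rfl⟩ := h.surjective_q y
  exact DFunLike.congr_fun this x

end IsArrowRemoval

/-! ### Vanishing of `Hom(eR, fR)` -/

theorem mul_mem_rightSpan {R : Type u} [Ring R] (f x : R) : f * x ∈ rightSpan R f :=
  Submodule.mem_span_singleton.2 ⟨MulOpposite.op x, rfl⟩

theorem homVanishes_iff {R : Type u} [Ring R] {e f : R} (he : e * e = e) :
    HomVanishes R e f ↔ ∀ x, f * x * e = 0 := by
  constructor
  · intro h x
    -- left multiplication by `f * x` is a homomorphism from `eR` to `fR`
    let g : rightSpan R e →ₗ[Rᵐᵒᵖ] rightSpan R f :=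
      { toFun := fun y => ⟨f * x * y, by rw [mul_assoc]; exact mul_mem_rightSpan f _⟩
        map_add' := fun y z => Subtype.ext (mul_add _ _ _)
        map_smul' := fun r y => Subtype.ext (mul_assoc _ _ _).symm }
    exact congrArg Subtype.val
      (DFunLike.congr_fun (h g) ⟨e, Submodule.mem_span_singleton_self e⟩)
  · intro h g
    have key : g ⟨e, Submodule.mem_span_singleton_self e⟩ = 0 := by
      have h1 : MulOpposite.op e • (⟨e, Submodule.mem_span_singleton_self e⟩ : rightSpan R e) =
          ⟨e, Submodule.mem_span_singleton_self e⟩ := Subtype.ext he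
      have h2 := g.map_smul (MulOpposite.op e) ⟨e, Submodule.mem_span_singleton_self e⟩
      rw [h1] at h2
      obtain ⟨r, hr⟩ := Submodule.mem_span_singleton.1
        (g ⟨e, Submodule.mem_span_singleton_self e⟩).2
      refine Subtype.ext ?_
      have h3 := congrArg Subtype.val h2
      rw [Submodule.coe_smul, ← hr] at h3
      rw [← hr]
      exact h3.trans (h r.unop)
    refine LinearMap.ext fun y => ?_
    obtain ⟨r, hr⟩ := Submodule.mem_span_singleton.1 y.2
    have : y = r • ⟨e, Submodule.mem_span_singleton_self e⟩ := Subtype.ext hr.symm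
    rw [this, map_smul, key, smul_zero]
    rfl

/-! ### One arrow: the trivial extension -/

namespace IsArrowRemoval

variable {k : Type w} {V : Type u} [Quiver.{v} V] [Field k] [Fintype V]
  {I : TwoSidedIdeal (PathAlgebra k V)} {a : QArrow V} {Λ Γ : Type*} [Ring Λ] [Algebra k Λ]
  [Ring Γ] [Algebra k Γ] {q : PathAlgebra k V →ₐ[k] Λ} {π : PathAlgebra k V →ₐ[k] Γ}

/-- If a path of `Γ` led back from the end of `a` to its start, `Λ` would contain elements that run
through `a` arbitrarily often, contradicting the nilpotency of `J` modulo `I`. -/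
theorem vertex_mul_mul_vertex (h : IsArrowRemoval I {a} q π) {m : ℕ}
    (hm : (arrowIdeal k V).asIdeal ^ m ≤ I.asIdeal) (x : Γ) :
    π (vertex k a.2.1) * x * π (vertex k a.1) = 0 := by
  obtain ⟨σ, hσ⟩ := h.exists_section
  set e := π (vertex k a.1) with he
  set f := π (vertex k a.2.1) with hf
  have hee : e * e = e := by rw [he, ← map_mul, vertex_mul_self]
  have hff : f * f = f := by rw [hf, ← map_mul, vertex_mul_self]
  by_contra hw
  set z := f * x * e with hz
  have hfz : f * z = z := by rw [hz, ← mul_assoc, ← mul_assoc, hff]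
  have hze : z * e = z := by rw [hz, mul_assoc, hee]
  obtain ⟨l, hl⟩ := Module.Projective.exists_dual_eq_one k hw
  -- `Γ` acts on itself from the right, and `a` is made to act by `y ↦ l (y * e) • f`.
  let ρ : Γ →ₐ[k] (Module.End k Γ)ᵐᵒᵖ :=
    { toFun := fun g => MulOpposite.op (LinearMap.mulRight k g)
      map_one' := by simp [LinearMap.mulRight_one]; rfl
      map_mul' := fun g g' => by
        rw [← MulOpposite.op_mul]
        exact congrArg _ (LinearMap.ext fun y => (mul_assoc y g g').symm)
      map_zero' := by simp
      map_add' := fun g g' => by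
        rw [← MulOpposite.op_add]
        exact congrArg _ (LinearMap.ext fun y => mul_add y g g')
      commutes' := fun c => by
        rw [MulOpposite.algebraMap_apply]
        refine congrArg _ (LinearMap.ext fun y => ?_)
        simp [Algebra.smul_def, Algebra.commutes] }
  let b : Module.End k Γ := (l.comp (LinearMap.mulRight k e)).smulRight f
  obtain ⟨θ, hθ, hθa⟩ := h.exists_lift hσ ρ (fun _ => MulOpposite.op b)
    (by
      rintro _ rfl
      rw [← he]
      change MulOpposite.op (b * LinearMap.mulRight k e) = _
      refine congrArg _ (LinearMap.ext fun y => ?_)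
      simp [b, mul_assoc, hee])
    (by
      rintro _ rfl
      rw [← hf]
      change MulOpposite.op (LinearMap.mulRight k f * b) = _
      refine congrArg _ (LinearMap.ext fun y => ?_)
      simp [b, hff])
  obtain ⟨x', hx'⟩ := h.surjective_q (σ z)
  have hnil : (q (x' * arrow k a)) ^ m = 0 := by
    rw [← map_pow, h.q_eq_zero_iff]
    exact hm (Ideal.pow_mem_pow (Ideal.mul_mem_left _ _ (arrow_mem_arrowIdeal a)) m)
  have hact : (θ (q (x' * arrow k a))).unop f = f := by
    rw [map_mul, hx', map_mul, hθ, hθa a rfl]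
    change b (f * z) = f
    rw [hfz]
    simp [b, hze, hl]
  have hpow : ∀ n : ℕ, ((θ (q (x' * arrow k a))) ^ n).unop f = f := by
    intro n
    induction n with
    | zero => simp
    | succ n ih => rw [pow_succ', MulOpposite.unop_mul, Module.End.mul_apply, hact, ih]
  have hf0 : f = 0 := by
    rw [← hpow m, ← map_pow, hnil, map_zero]
    rfl
  rw [← hfz, hf0, zero_mul] at hw
  exact hw rfl

/-- If `fΓe = 0`, then the free adjunction of `a : e → f` to `Γ` is the trivial extension of `Γ` by
`Γe ⊗ fΓ`. -/
theorem exists_equiv_trivSqZeroExt (h : IsArrowRemoval I {a} q π)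
    (hfe : ∀ x, π (vertex k a.2.1) * x * π (vertex k a.1) = 0) :
    ∃ φ : Λ ≃ₐ[k] TrivSqZeroExt Γ (ProjBimodule k (π (vertex k a.1)) (π (vertex k a.2.1))),
      (∀ x, deletion k {a} x = x → φ (q x) = TrivSqZeroExt.inl (π x)) ∧
        φ (q (arrow k a)) = TrivSqZeroExt.inr (ProjBimodule.gen k _ _) := by
  obtain ⟨σ, hσ⟩ := h.exists_section
  set e := π (vertex k a.1) with he
  set f := π (vertex k a.2.1) with hf
  have hee : e * e = e := by rw [he, ← map_mul, vertex_mul_self]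
  have hff : f * f = f := by rw [hf, ← map_mul, vertex_mul_self]
  set M := ProjBimodule k e f
  have hσe : σ e * q (arrow k a) = q (arrow k a) := by
    rw [he, hσ, deletion_vertex, ← map_mul, vertex_mul_arrow]
  have hσf : q (arrow k a) * σ f = q (arrow k a) := by
    rw [hf, hσ, deletion_vertex, ← map_mul, arrow_mul_vertex]
  obtain ⟨φ, hφ, hφa⟩ := h.exists_lift hσ (TrivSqZeroExt.inlAlgHom k Γ M)
    (fun _ => TrivSqZeroExt.inr (ProjBimodule.gen k e f))
    (by
      rintro _ rfl
      rw [← he, TrivSqZeroExt.inlAlgHom_apply, TrivSqZeroExt.inl_mul_inr]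
      refine congrArg _ ?_
      rw [ProjBimodule.gen, ProjBimodule.smul_tmul']
      exact congrArg₂ _ (Subtype.ext hee) rfl)
    (by
      rintro _ rfl
      rw [← hf, TrivSqZeroExt.inlAlgHom_apply, TrivSqZeroExt.inr_mul_inl]
      refine congrArg _ ?_
      rw [ProjBimodule.gen, ProjBimodule.op_smul_tmul]
      exact congrArg₂ _ rfl (Subtype.ext hff))
  let sl : leftSpan Γ e →ₗ[k] Λ :=
    (LinearMap.mulRight k (q (arrow k a))).comp
      (σ.toLinearMap.comp ((leftSpan Γ e).subtype.restrictScalars k))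
  let sr : rightSpan Γ f →ₗ[k] Λ :=
    σ.toLinearMap.comp ((rightSpan Γ f).subtype.restrictScalars k)
  let g : M →ₗ[k] Λ :=
    (TensorProduct.lift ((LinearMap.mul k Λ).compl₁₂ sl sr) :
      leftSpan Γ e ⊗[k] rightSpan Γ f →ₗ[k] Λ)
  have hg : ∀ x y, g (ProjBimodule.tmul x y) = σ x * q (arrow k a) * σ y := fun x y => rfl
  have hgg : ∀ x y, g x * g y = 0 := by
    intro x y
    induction x using ProjBimodule.induction_tmul with
    | h0 => rw [map_zero, zero_mul]
    | hadd x x' hx hx' => rw [map_add, add_mul, hx, hx', add_zero]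
    | ht x x' =>
      induction y using ProjBimodule.induction_tmul with
      | h0 => rw [map_zero, mul_zero]
      | hadd x x' hx hx' => rw [map_add, mul_add, hx, hx', add_zero]
      | ht y y' =>
        obtain ⟨r, hr⟩ := Submodule.mem_span_singleton.1 x'.2
        obtain ⟨s, hs⟩ := Submodule.mem_span_singleton.1 y.2
        have h0 : (x' : Γ) * y = 0 := by
          rw [← hr, ← hs]
          change f * r.unop * (s * e) = 0
          rw [← mul_assoc, mul_assoc f, hfe]
        rw [hg, hg]
        calc _ = σ x * q (arrow k a) * (σ (x' * y)) * (q (arrow k a) * σ y') := by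
              rw [map_mul]; noncomm_ring
          _ = 0 := by rw [h0, map_zero, mul_zero, zero_mul]
  let ψ : TrivSqZeroExt Γ M →ₐ[k] Λ := TrivSqZeroExt.lift σ g hgg
    (by
      intro r x
      induction x using ProjBimodule.induction_tmul with
      | h0 => simp
      | hadd x x' hx hx' => rw [smul_add, map_add, hx, hx', map_add, mul_add]
      | ht x y =>
        rw [ProjBimodule.smul_tmul', hg, hg, Submodule.coe_smul, smul_eq_mul, map_mul]
        noncomm_ring)
    (by
      intro r x
      induction x using ProjBimodule.induction_tmul with
      | h0 => simp
      | hadd x x' hx hx' => rw [smul_add, map_add, hx, hx', map_add, add_mul]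
      | ht x y =>
        rw [ProjBimodule.op_smul_tmul, hg, hg, Submodule.coe_smul, MulOpposite.smul_eq_mul_unop,
          map_mul]
        noncomm_ring)
  have hψgen : ψ (TrivSqZeroExt.inr (ProjBimodule.gen k e f)) = q (arrow k a) := by
    rw [TrivSqZeroExt.lift_apply_inr, ProjBimodule.gen, hg]
    rw [hσe, hσf]
  have h1 : ψ.comp φ = AlgHom.id k Λ := by
    refine h.algHom_ext hσ (fun y => ?_) ?_
    · rw [AlgHom.comp_apply, hφ, TrivSqZeroExt.inlAlgHom_apply, TrivSqZeroExt.lift_apply_inl]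
      rfl
    · rintro _ rfl
      rw [AlgHom.comp_apply, hφa _ rfl, hψgen]
      rfl
  have h2 : φ.comp ψ = AlgHom.id k _ := by
    refine TrivSqZeroExt.algHom_ext' (AlgHom.ext fun y => ?_) (LinearMap.ext fun y => ?_)
    · change φ (ψ (TrivSqZeroExt.inl y)) = _
      rw [TrivSqZeroExt.lift_apply_inl, hφ]
      rfl
    · change φ (ψ (TrivSqZeroExt.inr y)) = TrivSqZeroExt.inr y
      rw [TrivSqZeroExt.lift_apply_inr]
      induction y using ProjBimodule.induction_tmul with
      | h0 => simp
      | hadd x x' hx hx' => rw [map_add, map_add, hx, hx', TrivSqZeroExt.inr_add]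
      | ht x y =>
        obtain ⟨r, hr⟩ := Submodule.mem_span_singleton.1 x.2
        obtain ⟨s, hs⟩ := Submodule.mem_span_singleton.1 y.2
        rw [hg, map_mul, map_mul, hφ, hφ, hφa _ rfl, TrivSqZeroExt.inlAlgHom_apply,
          TrivSqZeroExt.inlAlgHom_apply, TrivSqZeroExt.inl_mul_inr, TrivSqZeroExt.inr_mul_inl,
          ProjBimodule.gen, ProjBimodule.smul_tmul', ProjBimodule.op_smul_tmul]
        refine congrArg _ (congrArg₂ _ (Subtype.ext ?_) (Subtype.ext ?_))
        · change (x : Γ) * e = x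
          rw [← hr, smul_eq_mul, mul_assoc, hee]
        · change f * (y : Γ) = y
          rw [← hs]
          change f * (f * s.unop) = f * s.unop
          rw [← mul_assoc, hff]
  refine ⟨AlgEquiv.ofAlgHom φ ψ h2 h1, fun x hx => ?_, hφa a rfl⟩
  have := hφ (π x)
  rw [hσ, hx] at this
  exact this

theorem q_mul_eq_zero (h : IsArrowRemoval I {a} q π)
    (hfe : ∀ x, π (vertex k a.2.1) * x * π (vertex k a.1) = 0) {x y : PathAlgebra k V}
    (hx : π x = 0) (hy : π y = 0) : q (x * y) = 0 := by
  obtain ⟨φ, hφ, hφa⟩ := h.exists_equiv_trivSqZeroExt hfe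
  have hfst : ∀ x, (φ (q x)).fst = π x := by
    have : ((TrivSqZeroExt.fstHom k _ _).comp φ.toAlgHom).comp q = π := by
      refine PathAlgebra.algHom_ext (fun i => ?_) fun b => ?_
      · exact congrArg TrivSqZeroExt.fst (hφ _ (deletion_vertex i))
      · by_cases hb : b ∈ ({a} : Set (QArrow V))
        · rw [h.pi_arrow hb, hb]
          exact congrArg TrivSqZeroExt.fst hφa
        · exact congrArg TrivSqZeroExt.fst (hφ _ (deletion_arrow_of_notMem hb))
    exact fun x => DFunLike.congr_fun this x
  rw [← map_eq_zero_iff φ φ.injective, map_mul, map_mul,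
    ← TrivSqZeroExt.inl_fst_add_inr_snd_eq (φ (q x)),
    ← TrivSqZeroExt.inl_fst_add_inr_snd_eq (φ (q y)), hfst, hfst, hx, hy,
    TrivSqZeroExt.inl_zero, zero_add, zero_add, TrivSqZeroExt.inr_mul_inr]

end IsArrowRemoval

section Removal

variable {k : Type w} {V : Type u} [Quiver.{v} V] [Field k] [Fintype V]

/-- The class map `kQ → kQ/I` as a homomorphism of `k`-algebras. -/
noncomputable abbrev quiverMk (I : TwoSidedIdeal (PathAlgebra k V)) :
    PathAlgebra k V →ₐ[k] QuiverAlgebra I :=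
  Ideal.Quotient.mkₐ k I.asIdeal

/-- The class map `kQ → (kQ/I)/⟨A⟩` as a homomorphism of `k`-algebras. -/
noncomputable abbrev removalMk (I : TwoSidedIdeal (PathAlgebra k V)) (A : Set (QArrow V)) :
    PathAlgebra k V →ₐ[k] ArrowRemoval I A :=
  (Ideal.Quotient.mkₐ k (removalIdeal I A).asIdeal).comp (quiverMk I)

variable {I : TwoSidedIdeal (PathAlgebra k V)} {A : Set (QArrow V)}

theorem quiverMk_surjective : Function.Surjective (quiverMk I) :=
  Ideal.Quotient.mk_surjective

theorem quiverMk_eq_zero_iff (x : PathAlgebra k V) : quiverMk I x = 0 ↔ x ∈ I :=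
  Ideal.Quotient.eq_zero_iff_mem.trans TwoSidedIdeal.mem_asIdeal

theorem removalMk_surjective : Function.Surjective (removalMk I A) :=
  Ideal.Quotient.mk_surjective.comp quiverMk_surjective

theorem removalMk_eq_zero_iff (x : PathAlgebra k V) :
    removalMk I A x = 0 ↔ x ∈ I ⊔ TwoSidedIdeal.span (arrow k '' A) := by
  constructor
  · intro hx
    obtain ⟨θ, hθ⟩ := AlgHom.exists_factor quiverMk_surjective
      (quiverMk (I ⊔ TwoSidedIdeal.span (arrow k '' A))) (f := quiverMk I) fun y hy =>
        (quiverMk_eq_zero_iff y).2 ((le_sup_left : I ≤ _) ((quiverMk_eq_zero_iff y).1 hy))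
    have hle : removalIdeal I A ≤ (⊥ : TwoSidedIdeal _).comap θ := by
      refine TwoSidedIdeal.span_le.2 ?_
      rintro _ ⟨a, ha, rfl⟩
      rw [SetLike.mem_coe, TwoSidedIdeal.mem_comap, TwoSidedIdeal.mem_bot]
      refine (hθ _).trans ((quiverMk_eq_zero_iff _).2 ?_)
      exact (le_sup_right : _ ≤ I ⊔ TwoSidedIdeal.span (arrow k '' A))
        (TwoSidedIdeal.subset_span ⟨a, ha, rfl⟩)
    have hx' := hle (TwoSidedIdeal.mem_asIdeal.1 (Ideal.Quotient.eq_zero_iff_mem.1 hx))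
    rw [TwoSidedIdeal.mem_comap, TwoSidedIdeal.mem_bot] at hx'
    exact (quiverMk_eq_zero_iff x).1 ((hθ x).symm.trans hx')
  · intro hx
    have hle : I ⊔ TwoSidedIdeal.span (arrow k '' A) ≤
        (⊥ : TwoSidedIdeal _).comap (removalMk I A) := by
      refine sup_le (fun y hy => ?_) (TwoSidedIdeal.span_le.2 ?_)
      · rw [TwoSidedIdeal.mem_comap, TwoSidedIdeal.mem_bot, AlgHom.comp_apply,
          (quiverMk_eq_zero_iff y).2 hy, map_zero]
      · rintro _ ⟨a, ha, rfl⟩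
        rw [SetLike.mem_coe, TwoSidedIdeal.mem_comap, TwoSidedIdeal.mem_bot, AlgHom.comp_apply]
        exact Ideal.Quotient.eq_zero_iff_mem.2
          (TwoSidedIdeal.mem_asIdeal.2 (TwoSidedIdeal.subset_span ⟨a, ha, rfl⟩))
    simpa [TwoSidedIdeal.mem_comap, TwoSidedIdeal.mem_bot] using hle hx

theorem AvoidsArrows.isArrowRemoval (h : AvoidsArrows I A) :
    IsArrowRemoval I A (quiverMk I) (removalMk I A) where
  exists_span_eq := h.exists_span_eq
  surjective_q := quiverMk_surjective
  q_eq_zero_iff := quiverMk_eq_zero_iff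
  surjective_pi := removalMk_surjective
  pi_eq_zero_iff := removalMk_eq_zero_iff

/-- The ideal generated by the relations of `(kQ/I)/⟨A⟩` that involve no arrow of `A`. -/
noncomputable def reducedIdeal (I : TwoSidedIdeal (PathAlgebra k V)) (A : Set (QArrow V)) :
    TwoSidedIdeal (PathAlgebra k V) :=
  TwoSidedIdeal.span
    {x | deletion k A x = x ∧ x ∈ I ⊔ TwoSidedIdeal.span (arrow k '' A)}

theorem reducedIdeal_sup :
    reducedIdeal I A ⊔ TwoSidedIdeal.span (arrow k '' A) =
      I ⊔ TwoSidedIdeal.span (arrow k '' A) := by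
  refine le_antisymm (sup_le (TwoSidedIdeal.span_le.2 fun x hx => hx.2) le_sup_right)
    (sup_le (fun x hx => ?_) le_sup_right)
  have hd := sub_deletion_mem (A := A) x
  rw [← sub_add_cancel x (deletion k A x)]
  refine TwoSidedIdeal.add_mem _ ((le_sup_right : _ ≤ reducedIdeal I A ⊔ _) hd)
    ((le_sup_left : _ ≤ reducedIdeal I A ⊔ _)
      (TwoSidedIdeal.subset_span ⟨deletion_deletion x, ?_⟩))
  rw [← sub_sub_cancel x (deletion k A x)]
  exact TwoSidedIdeal.sub_mem _ ((le_sup_left : I ≤ _) hx)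
    ((le_sup_right : _ ≤ I ⊔ _) hd)

theorem isArrowRemoval_reducedIdeal :
    IsArrowRemoval (reducedIdeal I A) A (quiverMk (reducedIdeal I A)) (removalMk I A) where
  exists_span_eq := ⟨_, rfl, fun _ hx => hx.1⟩
  surjective_q := quiverMk_surjective
  q_eq_zero_iff := quiverMk_eq_zero_iff
  surjective_pi := removalMk_surjective
  pi_eq_zero_iff x := by rw [removalMk_eq_zero_iff, reducedIdeal_sup]

variable {a : QArrow V}

theorem isAdmissible_reducedIdeal (hI : IsAdmissible I)
    (hfe : ∀ x, removalMk I {a} (vertex k a.2.1) * x * removalMk I {a} (vertex k a.1) = 0) :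
    IsAdmissible (reducedIdeal I {a}) := by
  obtain ⟨hsq, m, hm2, hm⟩ := hI
  refine ⟨fun x hx => ?_, m + m, by omega, ?_⟩
  · have hle : reducedIdeal I {a} ≤ ((arrowIdeal k V).asIdeal ^ 2).toTwoSided := by
      refine TwoSidedIdeal.span_le.2 fun y hy => ?_
      obtain ⟨hy, hyK⟩ := hy
      rw [SetLike.mem_coe, Ideal.mem_toTwoSided, ← hy]
      obtain ⟨y₁, h₁, y₂, h₂, rfl⟩ : ∃ y₁ ∈ I, ∃ y₂ ∈ TwoSidedIdeal.span (arrow k '' {a}),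
          y₁ + y₂ = y := by
        simpa using TwoSidedIdeal.mem_sup.1 hyK
      rw [map_add, deletion_eq_zero_of_mem h₂, add_zero]
      exact deletion_mem_arrowIdeal_sq (hsq (TwoSidedIdeal.mem_asIdeal.2 h₁))
    exact Ideal.mem_toTwoSided.1 (hle (TwoSidedIdeal.mem_asIdeal.1 hx))
  · have hzero : ∀ x ∈ (arrowIdeal k V).asIdeal ^ m, removalMk I {a} x = 0 := fun x hx =>
      (removalMk_eq_zero_iff x).2 ((le_sup_left : I ≤ _) (hm hx))
    rw [Ideal.IsTwoSided.pow_add]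
    -- `J ^ m` maps to the square-zero part of the trivial extension
    refine Ideal.mul_le.2 fun x hx y hy => TwoSidedIdeal.mem_asIdeal.2
      ((quiverMk_eq_zero_iff _).1 ?_)
    exact isArrowRemoval_reducedIdeal.q_mul_eq_zero hfe (hzero x hx) (hzero y hy)

theorem homVanishes_removal_iff :
    HomVanishes (ArrowRemoval I A) (ArrowRemoval.cls I A (vertex k a.1))
        (ArrowRemoval.cls I A (vertex k a.2.1)) ↔
      ∀ x, removalMk I A (vertex k a.2.1) * x * removalMk I A (vertex k a.1) = 0 :=
  homVanishes_iff (by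
    change removalMk I A _ * removalMk I A _ = removalMk I A _
    rw [← map_mul, vertex_mul_self])

theorem isIdentityOnRemoval_of_fixed {φ : QuiverAlgebra I ≃ₐ[k] RemovalTrivExt I a}
    (hφ : ∀ x, deletion k {a} x = x → φ (quiverMk I x) = TrivSqZeroExt.inl (removalMk I {a} x)) :
    IsIdentityOnRemoval I a φ := fun p hp =>
  hφ _ (deletion_path_of_not_contains p (by simpa using hp))

theorem IsIdentityOnRemoval.apply_of_fixed {φ : QuiverAlgebra I ≃ₐ[k] RemovalTrivExt I a}
    (hφ : IsIdentityOnRemoval I a φ) {x : PathAlgebra k V} (hx : deletion k {a} x = x) :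
    φ (quiverMk I x) = TrivSqZeroExt.inl (removalMk I {a} x) := by
  refine eq_on_deletion_fixed (A := {a}) (θ := φ.toAlgHom.comp (quiverMk I))
    (θ' := (TrivSqZeroExt.inlAlgHom k _ _).comp (removalMk I {a}))
    (fun i => hφ _ (QPath.not_contains_nil i a)) (fun b hb => hφ _ ?_) hx
  rw [Quiver.Hom.toPath, QPath.contains_cons]
  rintro (h | rfl)
  · exact QPath.not_contains_nil _ _ h
  · exact hb rfl

theorem AvoidsArrows.exists_isIdentityOnRemoval (hI : IsAdmissible I) (h : AvoidsArrows I {a}) :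
    HomVanishes (ArrowRemoval I {a}) (ArrowRemoval.cls I {a} (vertex k a.1))
        (ArrowRemoval.cls I {a} (vertex k a.2.1)) ∧
      ∃ φ : QuiverAlgebra I ≃ₐ[k] RemovalTrivExt I a, IsIdentityOnRemoval I a φ ∧
        φ (QuiverAlgebra.cls I (arrow k a)) = TrivSqZeroExt.inr (ProjBimodule.gen k _ _) := by
  obtain ⟨m, -, hm⟩ := hI.2
  have hfe := h.isArrowRemoval.vertex_mul_mul_vertex hm
  obtain ⟨φ, hφ, hφa⟩ := h.isArrowRemoval.exists_equiv_trivSqZeroExt hfe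
  exact ⟨homVanishes_removal_iff.2 hfe, φ, isIdentityOnRemoval_of_fixed hφ, hφa⟩

variable [∀ i j : V, Finite (i ⟶ j)]

theorem avoidsArrows_reducedIdeal (hI : IsAdmissible (reducedIdeal I A)) :
    AvoidsArrows (reducedIdeal I A) A :=
  avoidsArrows_of_span_eq hI rfl fun _ hx => hx.1

/-- An isomorphism with the trivial extension that is the identity on `Γ` forces the relations of `Γ`
to hold in `Λ`, and the relations of `Γ` suffice for `Λ` by comparing dimensions. -/
theorem avoidsArrows_of_isIdentityOnRemoval (hI : IsAdmissible I)
    (hom : HomVanishes (ArrowRemoval I {a}) (ArrowRemoval.cls I {a} (vertex k a.1))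
      (ArrowRemoval.cls I {a} (vertex k a.2.1)))
    {φ : QuiverAlgebra I ≃ₐ[k] RemovalTrivExt I a} (hφ : IsIdentityOnRemoval I a φ) :
    AvoidsArrows I {a} := by
  have hfe := homVanishes_removal_iff.1 hom
  obtain ⟨ψ, -⟩ := (isArrowRemoval_reducedIdeal (I := I) (A := {a})).exists_equiv_trivSqZeroExt hfe
  have hle : reducedIdeal I {a} ≤ I := TwoSidedIdeal.span_le.2 fun x hx => by
    rw [SetLike.mem_coe, ← quiverMk_eq_zero_iff, ← map_eq_zero_iff φ φ.injective,
      hφ.apply_of_fixed hx.1, (removalMk_eq_zero_iff x).2 hx.2, TrivSqZeroExt.inl_zero]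
  obtain ⟨θ, hθ⟩ := AlgHom.exists_factor (quiverMk_surjective (I := reducedIdeal I {a}))
    (quiverMk I) fun x hx =>
      (quiverMk_eq_zero_iff x).2 (hle ((quiverMk_eq_zero_iff x).1 hx))
  have hsurj : Function.Surjective θ := fun y => by
    obtain ⟨x, rfl⟩ := quiverMk_surjective y
    exact ⟨_, hθ x⟩
  obtain ⟨m, -, hm⟩ := hI.2
  have : Module.Finite k (QuiverAlgebra I) := finite_of_arrowIdeal_pow_le hm
  let ε : QuiverAlgebra (reducedIdeal I {a}) ≃ₗ[k] QuiverAlgebra I :=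
    (ψ.trans φ.symm).toLinearEquiv
  have : Module.Finite k (QuiverAlgebra (reducedIdeal I {a})) := Module.Finite.equiv ε.symm
  have hinj : Function.Injective θ :=
    (LinearMap.injective_iff_surjective_of_finrank_eq_finrank (f := θ.toLinearMap)
      ε.finrank_eq).2 hsurj
  have heq : reducedIdeal I {a} = I := le_antisymm hle fun x hx => by
    rw [← quiverMk_eq_zero_iff] at hx ⊢
    exact hinj (by rw [hθ, hx, map_zero])
  have hav := avoidsArrows_reducedIdeal (I := I) (A := {a}) (by rwa [heq])
  rwa [heq] at hav

theorem avoidsArrows_singleton_iff (hI : IsAdmissible I) :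
    AvoidsArrows I {a} ↔
      HomVanishes (ArrowRemoval I {a}) (ArrowRemoval.cls I {a} (vertex k a.1))
          (ArrowRemoval.cls I {a} (vertex k a.2.1)) ∧
        ∃ φ : QuiverAlgebra I ≃ₐ[k] RemovalTrivExt I a, IsIdentityOnRemoval I a φ :=
  ⟨fun h => ⟨(h.exists_isIdentityOnRemoval hI).1,
      let ⟨φ, hφ, _⟩ := (h.exists_isIdentityOnRemoval hI).2
      ⟨φ, hφ⟩⟩,
    fun ⟨hom, _, hφ⟩ => avoidsArrows_of_isIdentityOnRemoval hI hom hφ⟩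

theorem nonempty_equiv_removalTrivExt_iff (hI : IsAdmissible I) :
    HomVanishes (ArrowRemoval I {a}) (ArrowRemoval.cls I {a} (vertex k a.1))
          (ArrowRemoval.cls I {a} (vertex k a.2.1)) ∧
        Nonempty (QuiverAlgebra I ≃ₐ[k] RemovalTrivExt I a) ↔
      ∃ I' : TwoSidedIdeal (PathAlgebra k V), IsAdmissible I' ∧ AvoidsArrows I' {a} ∧
        I' ⊔ TwoSidedIdeal.span {arrow k a} = I ⊔ TwoSidedIdeal.span {arrow k a} ∧
        Nonempty (QuiverAlgebra I' ≃ₐ[k] QuiverAlgebra I) := by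
  constructor
  · rintro ⟨hom, ⟨φ⟩⟩
    have hfe := homVanishes_removal_iff.1 hom
    obtain ⟨ψ, -⟩ :=
      (isArrowRemoval_reducedIdeal (I := I) (A := {a})).exists_equiv_trivSqZeroExt hfe
    have hadm := isAdmissible_reducedIdeal hI hfe
    refine ⟨reducedIdeal I {a}, hadm, avoidsArrows_reducedIdeal hadm, ?_, ⟨ψ.trans φ.symm⟩⟩
    simpa using reducedIdeal_sup (I := I) (A := {a})
  · rintro ⟨I', hI', hav, hsup, ⟨ε⟩⟩
    -- both presentations have the same quotient `Γ`
    have h : IsArrowRemoval I' {a} (quiverMk I') (removalMk I {a}) :=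
      { hav.isArrowRemoval with
        surjective_pi := removalMk_surjective
        pi_eq_zero_iff := fun x => by
          rw [removalMk_eq_zero_iff, Set.image_singleton, hsup] }
    obtain ⟨m, -, hm⟩ := hI'.2
    have hfe := h.vertex_mul_mul_vertex hm
    obtain ⟨ψ, -⟩ := h.exists_equiv_trivSqZeroExt hfe
    exact ⟨homVanishes_removal_iff.2 hfe, ⟨ε.symm.trans ψ⟩⟩

end Removal

/-! ### Freely adjoining arrows to an algebra -/

/-- A `k`-algebra `R` that is obtained from a `k`-algebra `G` by freely adjoining elements
`arrow i = tgt i * arrow i * src i`, for idempotents `src i` and `tgt i` of `G`. No element of `G`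
leads from a target to a source, so that products of two arrows vanish. The conventions are those of
left modules: on a left module `X`, the element `arrow i` acts as a map from `src i • X` to
`tgt i • X`. -/
structure FreeArrowExtension (k : Type w) [Field k] (G R : Type u) [Ring G] [Algebra k G] [Ring R]
    [Algebra k R] (n : ℕ) where
  /-- The inclusion of the original algebra. -/
  incl : G →ₐ[k] R
  /-- The projection that sends the arrows to zero. -/
  proj : R →ₐ[k] G
  /-- The idempotents at the sources of the arrows. -/
  src : Fin n → G
  /-- The idempotents at the targets of the arrows. -/
  tgt : Fin n → G
  /-- The adjoined arrows. -/
  arrow : Fin n → R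
  proj_incl : ∀ g, proj (incl g) = g
  proj_arrow : ∀ i, proj (arrow i) = 0
  src_mul_src : ∀ i, src i * src i = src i
  tgt_mul_tgt : ∀ i, tgt i * tgt i = tgt i
  arrow_mul_src : ∀ i, arrow i * incl (src i) = arrow i
  tgt_mul_arrow : ∀ i, incl (tgt i) * arrow i = arrow i
  src_mul_mul_tgt : ∀ i j g, src i * g * tgt j = 0
  adjoin_eq_top : Algebra.adjoin k (Set.range incl ∪ Set.range arrow) = ⊤
  exists_lift : ∀ {B : Type u} [Ring B] [Algebra k B] (ρ : G →ₐ[k] B) (b : Fin n → B),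
    (∀ i, b i * ρ (src i) = b i) → (∀ i, ρ (tgt i) * b i = b i) →
      ∃ θ : R →ₐ[k] B, (∀ g, θ (incl g) = ρ g) ∧ ∀ i, θ (arrow i) = b i

/-- The subspace `eX` of a module `X`, for an idempotent `e`. -/
def corner (k : Type w) [Field k] {G : Type u} [Ring G] [Algebra k G] (e : G) (X : Type u)
    [AddCommGroup X] [Module k X] [Module G X] [IsScalarTower k G X] : Submodule k X where
  carrier := {x | e • x = x}
  add_mem' {x y} hx hy := by
    rw [Set.mem_ofPred_eq, smul_add, hx, hy]
  zero_mem' := smul_zero e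
  smul_mem' c x hx := by
    rw [Set.mem_ofPred_eq, smul_comm, hx]

namespace FreeArrowExtension

variable {k : Type w} [Field k] {G R : Type u} [Ring G] [Algebra k G] [Ring R] [Algebra k R]
  {n : ℕ} (E : FreeArrowExtension k G R n)

section Added

variable (X Y N : Type u) [AddCommGroup X] [Module k X] [Module G X] [IsScalarTower k G X]
  [AddCommGroup Y] [Module k Y] [Module G Y] [IsScalarTower k G Y]
  [AddCommGroup N] [Module k N] [Module G N] [IsScalarTower k G N]

/-- The `G`-module `⨁ i, G (tgt i) ⊗ₖ (src i) X`. It carries the values of the arrows on elements of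
`X` when these values are unconstrained. -/
abbrev Added : Type u :=
  ∀ i, leftSpan G (E.tgt i) ⊗[k] corner k (E.src i) X

/-- The value of the `i`-th arrow on an element of `X`. -/
noncomputable def single (i : Fin n) : X →ₗ[k] E.Added X :=
  (LinearMap.single k _ i).comp
    ((TensorProduct.mk k _ _ ⟨E.tgt i, Submodule.mem_span_singleton_self _⟩).comp
      ((Algebra.lsmul k k X (E.src i)).codRestrict (corner k (E.src i) X) fun x => by
        change E.src i • E.src i • x = E.src i • x
        rw [smul_smul, E.src_mul_src]))

variable {X Y N}

theorem single_apply (i : Fin n) (x : X) (hx : E.src i • E.src i • x = E.src i • x) :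
    E.single X i x = Pi.single i
      ((⟨E.tgt i, Submodule.mem_span_singleton_self _⟩ : leftSpan G (E.tgt i)) ⊗ₜ[k]
        (⟨E.src i • x, hx⟩ : corner k (E.src i) X)) := rfl

theorem single_src_smul (i : Fin n) (x : X) :
    E.single X i (E.src i • x) = E.single X i x := by
  have h : E.src i • E.src i • x = E.src i • x := by rw [smul_smul, E.src_mul_src]
  rw [E.single_apply i x h, E.single_apply i (E.src i • x) (by rw [h, h])]
  congr 4

theorem tgt_smul_single (i : Fin n) (x : X) :
    E.tgt i • E.single X i x = E.single X i x := by
  have h : E.src i • E.src i • x = E.src i • x := by rw [smul_smul, E.src_mul_src]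
  rw [E.single_apply i x h, ← Pi.single_smul, TensorProduct.smul_tmul']
  congr 2
  exact Subtype.ext (E.tgt_mul_tgt i)

theorem span_single_eq_top :
    Submodule.span G (⋃ i, Set.range (E.single X i)) = ⊤ := by
  refine eq_top_iff.2 fun m _ => ?_
  rw [← Finset.univ_sum_single m]
  refine Submodule.sum_mem _ fun i _ => ?_
  generalize m i = t
  induction t with
  | zero => rw [Pi.single_zero]; exact zero_mem _
  | add s t hs ht => rw [Pi.single_add]; exact add_mem hs ht
  | tmul y x =>
    obtain ⟨r, hr⟩ := Submodule.mem_span_singleton.1 y.2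
    have hx : E.src i • (x : X) = x := x.2
    have : (Pi.single i (y ⊗ₜ[k] x) : E.Added X) = r • E.single X i x := by
      rw [E.single_apply i (x : X) (by rw [hx, hx]), ← Pi.single_smul, TensorProduct.smul_tmul']
      congr 2
      · exact Subtype.ext hr.symm
      · exact Subtype.ext hx.symm
    rw [this]
    exact Submodule.smul_mem _ _ (Submodule.subset_span (Set.mem_iUnion.2 ⟨i, x, rfl⟩))

theorem added_hom_ext {M : Type*} [AddCommGroup M] [Module G M] {g g' : E.Added X →ₗ[G] M}
    (h : ∀ i x, g (E.single X i x) = g' (E.single X i x)) : g = g' := by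
  refine LinearMap.ext_on E.span_single_eq_top fun m hm => ?_
  obtain ⟨i, x, rfl⟩ := Set.mem_iUnion.1 hm
  exact h i x

theorem src_smul_added (j : Fin n) (m : E.Added X) : E.src j • m = 0 := by
  funext i
  change E.src j • m i = 0
  generalize m i = t
  induction t with
  | zero => exact smul_zero _
  | add s t hs ht => rw [smul_add, hs, ht, add_zero]
  | tmul y x =>
    obtain ⟨r, hr⟩ := Submodule.mem_span_singleton.1 y.2
    have : E.src j • y = 0 := Subtype.ext <| by
      rw [Submodule.coe_smul, ← hr, smul_eq_mul, smul_eq_mul, ← mul_assoc, E.src_mul_mul_tgt]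
      rfl
    rw [TensorProduct.smul_tmul', this, TensorProduct.zero_tmul]

/-- The `G`-linear map on the added part given by `k`-linear maps `X → N`, one for every arrow. -/
noncomputable def addedLift (β : Fin n → X →ₗ[k] N) : E.Added X →ₗ[G] N :=
  ∑ i, (TensorProduct.AlgebraTensorModule.lift
    ((LinearMap.toSpanSingleton G (corner k (E.src i) X →ₗ[k] N)
      ((β i).comp (corner k (E.src i) X).subtype)).comp (leftSpan G (E.tgt i)).subtype)).comp
        (LinearMap.proj i)

theorem addedLift_single (β : Fin n → X →ₗ[k] N) (i : Fin n) (x : X) :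
    E.addedLift β (E.single X i x) = E.tgt i • β i (E.src i • x) := by
  have h : E.src i • E.src i • x = E.src i • x := by rw [smul_smul, E.src_mul_src]
  rw [addedLift, LinearMap.sum_apply, Finset.sum_eq_single i]
  · rw [E.single_apply i x h, LinearMap.comp_apply, LinearMap.proj_apply, Pi.single_eq_same]
    rfl
  · intro j _ hj
    rw [E.single_apply i x h, LinearMap.comp_apply, LinearMap.proj_apply,
      Pi.single_eq_of_ne hj, map_zero]
  · simp

/-- Every surjection onto the added part splits. -/
theorem exists_section_added (g : N →ₗ[G] E.Added X) (hg : Function.Surjective g) :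
    ∃ s : E.Added X →ₗ[G] N, ∀ m, g (s m) = m := by
  have hk : ∀ i, ∃ s : X →ₗ[k] N, (g.restrictScalars k).comp s = E.single X i := fun i =>
    Module.projective_lifting_property (g.restrictScalars k) (E.single X i) hg
  choose s hs using hk
  refine ⟨E.addedLift s, fun m => ?_⟩
  have : g.comp (E.addedLift s) = LinearMap.id := E.added_hom_ext fun i x => by
    rw [LinearMap.comp_apply, addedLift_single, map_smul]
    have := LinearMap.congr_fun (hs i) (E.src i • x)
    rw [LinearMap.comp_apply, LinearMap.restrictScalars_apply] at this
    rw [this, single_src_smul, tgt_smul_single, LinearMap.id_apply]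
  exact LinearMap.congr_fun this m

/-- Functoriality of the subspaces `eX`. -/
def cornerMap (e : G) (g : X →ₗ[G] Y) : corner k e X →ₗ[k] corner k e Y :=
  (g.restrictScalars k).restrict fun x hx => by
    change e • g x = g x
    rw [← map_smul, show e • x = x from hx]

/-- Functoriality of the added part. -/
noncomputable def addedMap (g : X →ₗ[G] Y) : E.Added X →ₗ[G] E.Added Y :=
  LinearMap.pi fun i =>
    (TensorProduct.AlgebraTensorModule.lTensor G (leftSpan G (E.tgt i))
      (cornerMap (k := k) (E.src i) g)).comp (LinearMap.proj i)

theorem addedMap_apply (g : X →ₗ[G] Y) (m : E.Added X) (i : Fin n) :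
    E.addedMap g m i =
      (cornerMap (k := k) (E.src i) g).lTensor (leftSpan G (E.tgt i)) (m i) := rfl

theorem addedMap_single (g : X →ₗ[G] Y) (i : Fin n) (x : X) :
    E.addedMap g (E.single X i x) = E.single Y i (g x) := by
  have h : E.src i • E.src i • x = E.src i • x := by rw [smul_smul, E.src_mul_src]
  funext j
  rw [addedMap_apply, E.single_apply i x h, E.single_apply i (g x) (by simp only [← map_smul, h])]
  by_cases hj : j = i
  · subst hj
    rw [Pi.single_eq_same, Pi.single_eq_same, LinearMap.lTensor_tmul]
    congr 1
    exact Subtype.ext (map_smul g _ _)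
  · rw [Pi.single_eq_of_ne hj, Pi.single_eq_of_ne hj, map_zero]

theorem addedMap_injective {g : X →ₗ[G] Y} (hg : Function.Injective g) :
    Function.Injective (E.addedMap g) := by
  intro m m' h
  funext i
  refine Module.Flat.lTensor_preserves_injective_linearMap (cornerMap (k := k) (E.src i) g)
    (fun x y hxy => Subtype.ext (hg (congrArg Subtype.val hxy))) ?_
  exact congrFun h i

theorem cornerMap_surjective (e : G) (he : e * e = e) {g : X →ₗ[G] Y}
    (hg : Function.Surjective g) : Function.Surjective (cornerMap (k := k) e g) := by
  intro y
  obtain ⟨x, hx⟩ := hg y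
  refine ⟨⟨e • x, ?_⟩, Subtype.ext ?_⟩
  · change e • e • x = e • x
    rw [smul_smul, he]
  · change g (e • x) = y
    rw [map_smul, hx]
    exact y.2

theorem addedMap_surjective {g : X →ₗ[G] Y} (hg : Function.Surjective g) :
    Function.Surjective (E.addedMap g) := by
  intro m
  choose t ht using fun i => LinearMap.lTensor_surjective (leftSpan G (E.tgt i))
    (cornerMap_surjective (k := k) (E.src i) (E.src_mul_src i) hg) (m i)
  exact ⟨t, funext ht⟩

theorem addedMap_exact {g : X →ₗ[G] Y} {h : Y →ₗ[G] N} (hg : Function.Injective g)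
    (hgh : Function.Exact g h) (hh : Function.Surjective h) :
    Function.Exact (E.addedMap g) (E.addedMap h) := by
  have hex : ∀ i, Function.Exact (cornerMap (k := k) (E.src i) g)
      (cornerMap (k := k) (E.src i) h) := by
    intro i y
    constructor
    · intro hy
      obtain ⟨x, hx⟩ := (hgh y).1 (congrArg Subtype.val hy)
      refine ⟨⟨x, hg ?_⟩, Subtype.ext hx⟩
      rw [map_smul, hx]
      exact y.2
    · rintro ⟨x, rfl⟩
      exact Subtype.ext ((hgh _).2 ⟨x, rfl⟩)
  have hex' := fun i => lTensor_exact (leftSpan G (E.tgt i)) (hex i)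
    (cornerMap_surjective (k := k) (E.src i) (E.src_mul_src i) hh)
  intro m
  constructor
  · intro hm
    choose t ht using fun i => (hex' i (m i)).1 (congrFun hm i)
    exact ⟨t, funext ht⟩
  · rintro ⟨t, rfl⟩
    exact funext fun i => (hex' i _).2 ⟨t i, rfl⟩

end Added
end FreeArrowExtension

namespace FreeArrowExtension

variable {k : Type w} [Field k] {G R : Type u} [Ring G] [Algebra k G] [Ring R] [Algebra k R]
  {n : ℕ} (E : FreeArrowExtension k G R n)

/-! ### Modules over the extension -/

/-- The actions of `G` and of `R` on `N` agree along the inclusion of `G` into `R`. -/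
def Compatible (N : Type u) [AddCommGroup N] [Module G N] [Module R N] : Prop :=
  ∀ (g : G) (x : N), E.incl g • x = g • x

section Modules

variable {X Y N N' : Type u} [AddCommGroup X] [Module k X] [Module G X] [IsScalarTower k G X]
  [AddCommGroup Y] [Module k Y] [Module G Y] [IsScalarTower k G Y]
  [AddCommGroup N] [Module k N] [Module G N] [IsScalarTower k G N] [Module R N]
  [IsScalarTower k R N]
  [AddCommGroup N'] [Module G N'] [Module R N']

variable {E} in
/-- An `R`-linear map is `G`-linear. -/
def Compatible.restrict {M : Type u} [AddCommGroup M] [Module G M] [Module R M]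
    (hM : E.Compatible M) (hN' : E.Compatible N') (f : M →ₗ[R] N') : M →ₗ[G] N' where
  toFun := f
  map_add' := map_add f
  map_smul' g x := by rw [← hM, map_smul, hN', RingHom.id_apply]

variable {E} in
/-- A `G`-linear map that commutes with the arrows is `R`-linear. -/
def Compatible.extend {M : Type u} [AddCommGroup M] [Module G M] [Module R M]
    (hM : E.Compatible M) (hN' : E.Compatible N') (f : M →ₗ[G] N')
    (hf : ∀ i x, f (E.arrow i • x) = E.arrow i • f x) : M →ₗ[R] N' where
  toFun := f
  map_add' := map_add f
  map_smul' r x := by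
    have hr : r ∈ Algebra.adjoin k (Set.range E.incl ∪ Set.range E.arrow) := by
      rw [E.adjoin_eq_top]
      trivial
    rw [RingHom.id_apply]
    induction hr using Algebra.adjoin_induction generalizing x with
    | mem r h =>
      rcases h with ⟨g, rfl⟩ | ⟨i, rfl⟩
      · rw [hM, hN', map_smul]
      · exact hf i x
    | algebraMap c => rw [← E.incl.commutes, hM, hN', map_smul]
    | add r s _ _ hr hs => rw [add_smul, add_smul, map_add, hr, hs]
    | mul r s _ _ hr hs => rw [mul_smul, mul_smul, hr, hs]

/-- Arrows vanish on the images of `G`-linear maps from an added part. -/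
theorem arrow_smul_added {M : Type u} [AddCommGroup M] [Module G M] [Module R M]
    (hM : E.Compatible M) (f : E.Added X →ₗ[G] M) (i : Fin n) (m : E.Added X) :
    E.arrow i • f m = 0 := by
  rw [← E.arrow_mul_src, mul_smul, hM, ← map_smul, E.src_smul_added, map_zero, smul_zero]

/-- A module is projective if all surjections onto it from modules with compatible actions split. -/
theorem projective_of_splitting {P : Type u} [AddCommGroup P] [Module R P]
    (h : ∀ (N : Type u) [AddCommGroup N] [Module k N] [Module G N] [IsScalarTower k G N]
      [Module R N] [IsScalarTower k R N], E.Compatible N → ∀ f : N →ₗ[R] P,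
        Function.Surjective f → ∃ s : P →ₗ[R] N, f.comp s = LinearMap.id) :
    Module.Projective R P := by
  refine Module.Projective.of_lifting_property'' fun f hf => ?_
  let _ : Module G (P →₀ R) := Module.compHom _ (E.incl : G →+* R)
  have : IsScalarTower k G (P →₀ R) := ⟨fun c g x => by
    change E.incl (c • g) • x = c • E.incl g • x
    rw [map_smul, smul_assoc]⟩
  exact h (P →₀ R) (fun _ _ => rfl) f hf

/-- A `G`-module, viewed as an `R`-module on which the arrows act as zero. -/
def Inflation (_E : FreeArrowExtension k G R n) (Y : Type u) : Type u := Y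

instance : AddCommGroup (E.Inflation Y) := inferInstanceAs (AddCommGroup Y)

instance : Module G (E.Inflation Y) := inferInstanceAs (Module G Y)

instance : Module k (E.Inflation Y) := inferInstanceAs (Module k Y)

instance : IsScalarTower k G (E.Inflation Y) := inferInstanceAs (IsScalarTower k G Y)

instance : Module R (E.Inflation Y) := Module.compHom Y (E.proj : R →+* G)

instance : IsScalarTower k R (E.Inflation Y) := ⟨fun c r y => by
  change (E.proj (c • r) • y : E.Inflation Y) = c • (E.proj r • y : E.Inflation Y)
  rw [map_smul, smul_assoc]⟩

/-- A module and its inflation coincide as `G`-modules. -/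
def toInflation (Y : Type u) [AddCommGroup Y] [Module G Y] : Y ≃ₗ[G] E.Inflation Y :=
  LinearEquiv.refl G Y

theorem arrow_smul_inflation {Y : Type u} [AddCommGroup Y] [Module G Y] (i : Fin n) (y : E.Inflation Y) : E.arrow i • y = 0 := by
  change (E.proj (E.arrow i) • y : E.Inflation Y) = 0
  rw [E.proj_arrow, zero_smul]

theorem compatible_inflation {Y : Type u} [AddCommGroup Y] [Module G Y] :
    E.Compatible (E.Inflation Y) := fun g y => by
  change (E.proj (E.incl g) • y : E.Inflation Y) = g • y
  rw [E.proj_incl]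

/-- The added part is projective over `R`, since it is a direct sum of copies of the modules
`R (tgt i) = G (tgt i)`. -/
theorem projective_inflation_added : Module.Projective R (E.Inflation (E.Added X)) := by
  refine E.projective_of_splitting fun N _ _ _ _ _ _ hN f hf => ?_
  obtain ⟨s, hs⟩ := E.exists_section_added (X := X)
    ((E.toInflation (E.Added X)).symm.toLinearMap.comp
      (hN.restrict E.compatible_inflation f)) hf
  refine ⟨E.compatible_inflation.extend hN
    (s.comp (E.toInflation (E.Added X)).symm.toLinearMap) fun i x => ?_, LinearMap.ext hs⟩
  rw [arrow_smul_inflation, map_zero]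
  exact (E.arrow_smul_added hN s i _).symm

/-! ### Induced modules -/

theorem exists_action (X : Type u) [AddCommGroup X] [Module k X] [Module G X]
    [IsScalarTower k G X] :
    ∃ θ : R →ₐ[k] Module.End k (X × E.Added X),
      (∀ g, θ (E.incl g) = Algebra.lsmul k k (X × E.Added X) g) ∧
        ∀ i, θ (E.arrow i) = (LinearMap.inr k X (E.Added X)).comp
          ((E.single X i).comp (LinearMap.fst k X (E.Added X))) := by
  refine E.exists_lift (B := Module.End k (X × E.Added X))
    (Algebra.lsmul k k (X × E.Added X) : G →ₐ[k] _) _ (fun i => ?_) fun i => ?_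
  · refine LinearMap.ext fun z => Prod.ext rfl ?_
    exact E.single_src_smul i z.1
  · refine LinearMap.ext fun z => Prod.ext (smul_zero _) ?_
    exact E.tgt_smul_single i z.1

/-- The `R`-module `R ⊗_G X` induced by a `G`-module `X`. As a `G`-module it is the direct sum of `X`
and the added part, and the arrows map `X` freely into the added part. -/
def Induced (X : Type u) [AddCommGroup X] [Module k X] [Module G X] [IsScalarTower k G X] :
    Type u := X × E.Added X

instance : AddCommGroup (E.Induced X) := inferInstanceAs (AddCommGroup (X × E.Added X))

instance : Module G (E.Induced X) := inferInstanceAs (Module G (X × E.Added X))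

instance : Module k (E.Induced X) := inferInstanceAs (Module k (X × E.Added X))

instance : IsScalarTower k G (E.Induced X) := inferInstanceAs (IsScalarTower k G (X × E.Added X))

/-- The algebra homomorphism through which `R` acts on the induced module. -/
noncomputable def action (X : Type u) [AddCommGroup X] [Module k X] [Module G X]
    [IsScalarTower k G X] : R →ₐ[k] Module.End k (E.Induced X) :=
  (E.exists_action X).choose

noncomputable instance : Module R (E.Induced X) :=
  Module.compHom (E.Induced X) (E.action X : R →+* Module.End k (E.Induced X))

theorem induced_smul_def (r : R) (z : E.Induced X) : r • z = E.action X r z := rfl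

instance : IsScalarTower k R (E.Induced X) := ⟨fun c r z => by
  rw [induced_smul_def, induced_smul_def, map_smul, LinearMap.smul_apply]⟩

theorem compatible_induced : E.Compatible (E.Induced X) := fun g z =>
  LinearMap.congr_fun ((E.exists_action X).choose_spec.1 g) z

/-- The inclusion of `X` into the induced module. -/
def toInduced (X : Type u) [AddCommGroup X] [Module k X] [Module G X] [IsScalarTower k G X] :
    X →ₗ[G] E.Induced X := LinearMap.inl G X (E.Added X)

/-- The inclusion of the added part into the induced module. -/
def addedToInduced (X : Type u) [AddCommGroup X] [Module k X] [Module G X] [IsScalarTower k G X] :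
    E.Added X →ₗ[G] E.Induced X := LinearMap.inr G X (E.Added X)

theorem arrow_smul_induced (i : Fin n) (z : E.Induced X) :
    E.arrow i • z = E.addedToInduced X (E.single X i z.1) :=
  LinearMap.congr_fun ((E.exists_action X).choose_spec.2 i) z

theorem induced_eq_add (z : E.Induced X) :
    z = E.toInduced X z.1 + E.addedToInduced X z.2 :=
  Prod.ext (add_zero z.1).symm (zero_add z.2).symm

theorem induced_hom_ext (hN' : E.Compatible N') {f f' : E.Induced X →ₗ[R] N'}
    (h : ∀ x, f (E.toInduced X x) = f' (E.toInduced X x)) : f = f' := by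
  have hadd : (E.compatible_induced.restrict hN' f).comp (E.addedToInduced X) =
      (E.compatible_induced.restrict hN' f').comp (E.addedToInduced X) := by
    refine E.added_hom_ext fun i x => ?_
    have hx : E.addedToInduced X (E.single X i x) = E.arrow i • E.toInduced X x :=
      (E.arrow_smul_induced i (E.toInduced X x)).symm
    change f (E.addedToInduced X (E.single X i x)) = f' (E.addedToInduced X (E.single X i x))
    rw [hx, f.map_smul, f'.map_smul, h]
  refine LinearMap.ext fun z => ?_
  have hz : f (E.addedToInduced X z.2) = f' (E.addedToInduced X z.2) :=
    LinearMap.congr_fun hadd z.2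
  rw [E.induced_eq_add z, f.map_add, f'.map_add, h, hz]

/-- The linear map on the added part that is dictated by a linear map on `X`. -/
noncomputable def inducedLiftAdded (g : X →ₗ[G] N) : E.Added X →ₗ[G] N :=
  E.addedLift fun i => (Algebra.lsmul k k N (E.arrow i)).comp (g.restrictScalars k)

theorem inducedLiftAdded_single (hN : E.Compatible N) (g : X →ₗ[G] N) (i : Fin n) (x : X) :
    E.inducedLiftAdded g (E.single X i x) = E.arrow i • g x := by
  rw [inducedLiftAdded, addedLift_single]
  change E.tgt i • E.arrow i • g (E.src i • x) = _
  rw [map_smul, ← hN, ← hN, smul_smul, smul_smul, E.tgt_mul_arrow, E.arrow_mul_src]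

/-- The universal property of the induced module. -/
noncomputable def inducedLift (hN : E.Compatible N) (g : X →ₗ[G] N) : E.Induced X →ₗ[R] N :=
  E.compatible_induced.extend hN
    (LinearMap.coprod g (E.inducedLiftAdded g) : X × E.Added X →ₗ[G] N) fun i z => by
      rw [arrow_smul_induced]
      change g 0 + E.inducedLiftAdded g (E.single X i z.1) =
        E.arrow i • (g z.1 + E.inducedLiftAdded g z.2)
      rw [map_zero, zero_add, smul_add, E.arrow_smul_added hN, add_zero,
        E.inducedLiftAdded_single hN]

theorem inducedLift_apply (hN : E.Compatible N) (g : X →ₗ[G] N) (z : E.Induced X) :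
    E.inducedLift hN g z = g z.1 + E.inducedLiftAdded g z.2 := rfl

theorem inducedLift_toInduced (hN : E.Compatible N) (g : X →ₗ[G] N) (x : X) :
    E.inducedLift hN g (E.toInduced X x) = g x := by
  rw [inducedLift_apply]
  change g x + E.inducedLiftAdded g 0 = g x
  rw [map_zero, add_zero]

theorem projective_induced [Module.Projective G X] : Module.Projective R (E.Induced X) := by
  refine E.projective_of_splitting fun N _ _ _ _ _ _ hN f hf => ?_
  obtain ⟨s, hs⟩ := Module.projective_lifting_property
    (hN.restrict E.compatible_induced f) (E.toInduced X) hf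
  refine ⟨E.inducedLift hN s, E.induced_hom_ext E.compatible_induced fun x => ?_⟩
  rw [LinearMap.comp_apply, inducedLift_toInduced]
  exact LinearMap.congr_fun hs x

/-- Functoriality of the induced module. -/
noncomputable def inducedMap (g : X →ₗ[G] Y) : E.Induced X →ₗ[R] E.Induced Y :=
  E.compatible_induced.extend E.compatible_induced
    (LinearMap.prodMap g (E.addedMap g) : X × E.Added X →ₗ[G] Y × E.Added Y) fun i z => by
      rw [arrow_smul_induced, arrow_smul_induced]
      exact Prod.ext (map_zero g) (E.addedMap_single g i z.1)

theorem inducedMap_injective {g : X →ₗ[G] Y} (hg : Function.Injective g) :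
    Function.Injective (E.inducedMap g) :=
  Function.Injective.prodMap hg (E.addedMap_injective hg)

theorem inducedMap_surjective {g : X →ₗ[G] Y} (hg : Function.Surjective g) :
    Function.Surjective (E.inducedMap g) :=
  Function.Surjective.prodMap hg (E.addedMap_surjective hg)

theorem inducedMap_exact {Z : Type u} [AddCommGroup Z] [Module k Z] [Module G Z]
    [IsScalarTower k G Z] {g : X →ₗ[G] Y} {h : Y →ₗ[G] Z} (hg : Function.Injective g)
    (hgh : Function.Exact g h) (hh : Function.Surjective h) :
    Function.Exact (E.inducedMap g) (E.inducedMap h) := by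
  intro z
  have h1 := hgh z.1
  have h2 := E.addedMap_exact hg hgh hh z.2
  constructor
  · intro hz
    obtain ⟨x, hx⟩ := h1.1 (congrArg Prod.fst hz)
    obtain ⟨m, hm⟩ := h2.1 (congrArg Prod.snd hz)
    exact ⟨(x, m), Prod.ext hx hm⟩
  · rintro ⟨y, rfl⟩
    exact Prod.ext ((hgh _).2 ⟨y.1, rfl⟩) ((E.addedMap_exact hg hgh hh _).2 ⟨y.2, rfl⟩)

/-- The embedding of the added part as the kernel of the multiplication map `R ⊗_G N → N`. The
arrows act on this kernel as zero. -/
noncomputable def addedToKernel (N : Type u) [AddCommGroup N] [Module k N] [Module G N]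
    [IsScalarTower k G N] [Module R N] [IsScalarTower k R N] :
    E.Inflation (E.Added N) →ₗ[R] E.Induced N :=
  E.compatible_inflation.extend E.compatible_induced
    ((E.addedToInduced N - (E.toInduced N).comp (E.inducedLiftAdded LinearMap.id)).comp
      (E.toInflation (E.Added N)).symm.toLinearMap) fun i m => by
      rw [arrow_smul_inflation, map_zero, arrow_smul_induced]
      change 0 = E.addedToInduced N (E.single N i (0 - E.inducedLiftAdded LinearMap.id
        ((E.toInflation (E.Added N)).symm m)))
      rw [zero_sub, ← single_src_smul, smul_neg, ← map_smul, E.src_smul_added, map_zero, neg_zero,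
        map_zero, map_zero]

theorem addedToKernel_fst (m : E.Added N) :
    (E.addedToKernel N (E.toInflation _ m)).1 = -E.inducedLiftAdded LinearMap.id m :=
  zero_sub _

theorem addedToKernel_snd (m : E.Added N) :
    (E.addedToKernel N (E.toInflation _ m)).2 = m :=
  sub_zero m

theorem addedToKernel_injective :
    Function.Injective (E.addedToKernel N) := fun x y h => by
  have := congrArg Prod.snd h
  exact (E.addedToKernel_snd x).symm.trans (this.trans (E.addedToKernel_snd y))

theorem addedToKernel_exact (hN : E.Compatible N) :
    Function.Exact (E.addedToKernel N) (E.inducedLift hN (LinearMap.id : N →ₗ[G] N)) := by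
  intro z
  rw [inducedLift_apply, LinearMap.id_apply]
  constructor
  · intro hz
    refine ⟨E.toInflation _ z.2, Prod.ext ?_ (E.addedToKernel_snd z.2)⟩
    exact (E.addedToKernel_fst z.2).trans (neg_eq_of_add_eq_zero_left hz)
  · rintro ⟨m, rfl⟩
    have h1 := E.addedToKernel_fst m
    have h2 := E.addedToKernel_snd m
    exact (congrArg₂ (fun a b => a + E.inducedLiftAdded LinearMap.id b) h1 h2).trans
      (neg_add_cancel _)

theorem inducedLift_surjective (hN : E.Compatible N) {g : X →ₗ[G] N}
    (hg : Function.Surjective g) : Function.Surjective (E.inducedLift hN g) := fun x => by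
  obtain ⟨y, rfl⟩ := hg x
  exact ⟨_, E.inducedLift_toInduced hN g y⟩

end Modules
end FreeArrowExtension

/-! ### Projective dimensions -/

section ProjectiveDimension

variable {S : Type u} [Ring S]

theorem hasProjectiveDimensionLT_zero_iff_subsingleton (M : Type u) [AddCommGroup M] [Module S M] :
    HasProjectiveDimensionLT (ModuleCat.of S M) 0 ↔ Subsingleton M := by
  rw [hasProjectiveDimensionLT_zero_iff_isZero]
  exact ModuleCat.isZero_iff_subsingleton (M := ModuleCat.of S M)

theorem hasProjectiveDimensionLT_one_iff_projective (M : Type u) [AddCommGroup M] [Module S M] :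
    HasProjectiveDimensionLT (ModuleCat.of S M) 1 ↔ Module.Projective S M := by
  rw [← projective_iff_hasProjectiveDimensionLT_one]
  exact (IsProjective.iff_projective M).symm

variable {A B C : Type u} [AddCommGroup A] [Module S A] [AddCommGroup B] [Module S B]
  [AddCommGroup C] [Module S C] {f : A →ₗ[S] B} {g : B →ₗ[S] C}

theorem shortExact_of_exact (hf : Function.Injective f) (hfg : Function.Exact f g)
    (hg : Function.Surjective g) :
    (ModuleCat.shortComplexOfCompEqZero f g hfg.linearMap_comp_eq_zero).ShortExact :=
  ModuleCat.shortComplex_shortExact _ hfg hf hg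

theorem hasProjectiveDimensionLT_add_two_iff [Module.Projective S B] (hf : Function.Injective f)
    (hfg : Function.Exact f g) (hg : Function.Surjective g) (n : ℕ) :
    HasProjectiveDimensionLT (ModuleCat.of S C) (n + 2) ↔
      HasProjectiveDimensionLT (ModuleCat.of S A) (n + 1) :=
  (shortExact_of_exact hf hfg hg).hasProjectiveDimensionLT_X₃_iff n
    ((IsProjective.iff_projective B).1 inferInstance)

end ProjectiveDimension

namespace FreeArrowExtension

variable {k : Type w} [Field k] {G R : Type u} [Ring G] [Algebra k G] [Ring R] [Algebra k R]
  {n : ℕ} (E : FreeArrowExtension k G R n)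

/-- Induction does not increase projective dimensions: it is exact and preserves projectivity. -/
theorem hasProjectiveDimensionLT_induced (d : ℕ) (X : Type u) [AddCommGroup X] [Module k X]
    [Module G X] [IsScalarTower k G X] (h : HasProjectiveDimensionLT (ModuleCat.of G X) d) :
    HasProjectiveDimensionLT (ModuleCat.of R (E.Induced X)) d := by
  induction d using Nat.twoStepInduction generalizing X with
  | zero =>
    rw [hasProjectiveDimensionLT_zero_iff_subsingleton] at h ⊢
    have : Subsingleton (E.Added X) := ⟨fun m m' => by
      have hm : ∀ m : E.Added X, m = 0 := fun m =>
        LinearMap.congr_fun (E.added_hom_ext (g := (LinearMap.id : E.Added X →ₗ[G] _)) (g' := 0)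
          fun i x => by rw [Subsingleton.elim x 0, map_zero, map_zero, map_zero]) m
      rw [hm m, hm m']⟩
    exact inferInstanceAs (Subsingleton (X × E.Added X))
  | one =>
    rw [hasProjectiveDimensionLT_one_iff_projective] at h ⊢
    exact E.projective_induced
  | more d _ ih =>
    let g : (X →₀ G) →ₗ[G] X := Finsupp.linearCombination G id
    have hg : Function.Surjective g := Finsupp.linearCombination_id_surjective G X
    have hf := (LinearMap.ker g).injective_subtype
    have hfg : Function.Exact (LinearMap.ker g).subtype g := LinearMap.exact_subtype_ker_map g
    have := E.projective_induced (X := X →₀ G)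
    have hx := E.inducedMap_exact (X := LinearMap.ker g) (Y := X →₀ G) (Z := X)
      (g := (LinearMap.ker g).subtype) (h := g) hf hfg hg
    rw [hasProjectiveDimensionLT_add_two_iff (E.inducedMap_injective hf)
      hx (E.inducedMap_surjective hg)]
    exact ih _ ((hasProjectiveDimensionLT_add_two_iff hf hfg hg d).1 h)

variable {N : Type u} [AddCommGroup N] [Module k N] [Module G N] [IsScalarTower k G N] [Module R N]
  [IsScalarTower k R N] {E}

/-- The projective dimension over `R` is at most the maximum of `1` and the projective dimension
over `G`, because the kernel of `R ⊗_G N → N` is projective. -/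
theorem Compatible.hasProjectiveDimensionLT_add_two (hN : E.Compatible N) (d : ℕ)
    (h : HasProjectiveDimensionLT (ModuleCat.of G N) (d + 2)) :
    HasProjectiveDimensionLT (ModuleCat.of R N) (d + 2) := by
  have hK : HasProjectiveDimensionLT (ModuleCat.of R (E.Inflation (E.Added N))) 1 :=
    (hasProjectiveDimensionLT_one_iff_projective _).2 E.projective_inflation_added
  have hS := shortExact_of_exact E.addedToKernel_injective (E.addedToKernel_exact hN)
    (E.inducedLift_surjective hN Function.surjective_id)
  exact hS.hasProjectiveDimensionLT_X₃ (d + 1) (hasProjectiveDimensionLT_of_ge _ 1 _ (by omega))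
    (E.hasProjectiveDimensionLT_induced (d + 2) N h)

/-- Projective `R`-modules are projective over `G`: they are direct summands of modules induced by
free modules. -/
theorem Compatible.projective_restrict (hN : E.Compatible N) [Module.Projective R N] :
    Module.Projective G N := by
  let g : (N →₀ G) →ₗ[G] N := Finsupp.linearCombination G id
  have hg : Function.Surjective g := Finsupp.linearCombination_id_surjective G N
  obtain ⟨s, hs⟩ := Module.projective_lifting_property (E.inducedLift hN g) LinearMap.id
    (E.inducedLift_surjective hN hg)
  have : Module.Projective G (E.Added (N →₀ G)) :=
    Module.Projective.of_lifting_property'' fun f hf =>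
      let ⟨s, hs⟩ := E.exists_section_added f hf
      ⟨s, LinearMap.ext hs⟩
  have : Module.Projective G (E.Induced (N →₀ G)) :=
    inferInstanceAs (Module.Projective G ((N →₀ G) × E.Added (N →₀ G)))
  exact Module.Projective.of_split (hN.restrict E.compatible_induced s)
    (E.compatible_induced.restrict hN (E.inducedLift hN g))
    (LinearMap.ext fun x => LinearMap.congr_fun hs x)

theorem Compatible.hasProjectiveDimensionLT_restrict (d : ℕ) {N : Type u} [AddCommGroup N]
    [Module k N] [Module G N] [IsScalarTower k G N] [Module R N] [IsScalarTower k R N]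
    (hN : E.Compatible N) (h : HasProjectiveDimensionLT (ModuleCat.of R N) d) :
    HasProjectiveDimensionLT (ModuleCat.of G N) d := by
  induction d using Nat.twoStepInduction generalizing N with
  | zero =>
    rw [hasProjectiveDimensionLT_zero_iff_subsingleton] at h ⊢
    exact h
  | one =>
    rw [hasProjectiveDimensionLT_one_iff_projective] at h ⊢
    exact hN.projective_restrict
  | more d _ ih =>
    let g : (N →₀ R) →ₗ[R] N := Finsupp.linearCombination R id
    have hg : Function.Surjective g := Finsupp.linearCombination_id_surjective R N
    have hf := (LinearMap.ker g).injective_subtype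
    have hfg : Function.Exact (LinearMap.ker g).subtype g := LinearMap.exact_subtype_ker_map g
    let _ : Module G (N →₀ R) := Module.compHom _ (E.incl : G →+* R)
    let _ : Module G (LinearMap.ker g) := Module.compHom _ (E.incl : G →+* R)
    have : IsScalarTower k G (N →₀ R) := ⟨fun c y x => by
      change E.incl (c • y) • x = c • E.incl y • x
      rw [map_smul, smul_assoc]⟩
    have : IsScalarTower k G (LinearMap.ker g) := ⟨fun c y x => by
      change E.incl (c • y) • x = c • E.incl y • x
      rw [map_smul, smul_assoc]⟩
    have hF : E.Compatible (N →₀ R) := fun _ _ => rfl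
    have hK : E.Compatible (LinearMap.ker g) := fun _ _ => rfl
    have : Module.Projective G (N →₀ R) := hF.projective_restrict
    have hK' := ih hK ((hasProjectiveDimensionLT_add_two_iff hf hfg hg d).1 h)
    exact (hasProjectiveDimensionLT_add_two_iff (f := hK.restrict hF (LinearMap.ker g).subtype)
      (g := hF.restrict hN g) hf hfg hg d).2 hK'

end FreeArrowExtension

/-! ### Finitistic dimensions -/

theorem projectiveDimension_le_of_forall {C D : Type*} [Category C] [Abelian C] [Category D]
    [Abelian D] {X : C} {Y : D}
    (h : ∀ d : ℕ, HasProjectiveDimensionLT Y d → HasProjectiveDimensionLT X d) :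
    projectiveDimension X ≤ projectiveDimension Y :=
  sInf_le_sInf fun _ hd i hi => h i (hd i hi)

namespace FreeArrowExtension

theorem Compatible.finite {k : Type w} [Field k] {G R : Type u} [Ring G] [Algebra k G] [Ring R]
    [Algebra k R] {n : ℕ} {E : FreeArrowExtension k G R n} {N : Type u} [AddCommGroup N]
    [Module G N] [Module R N] (hN : E.Compatible N) [hfin : Module.Finite G N] :
    Module.Finite R N := by
  obtain ⟨s, hs⟩ := hfin.fg_top
  refine ⟨⟨s, eq_top_iff.2 fun x _ => ?_⟩⟩
  have hx : x ∈ Submodule.span G (s : Set N) := hs ▸ Submodule.mem_top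
  induction hx using Submodule.span_induction with
  | mem x hx => exact Submodule.subset_span hx
  | zero => exact Submodule.zero_mem _
  | add x y _ _ hx hy => exact Submodule.add_mem _ (hx trivial) (hy trivial)
  | smul g x _ hx =>
    rw [← hN]
    exact Submodule.smul_mem _ _ (hx trivial)

variable {k : Type w} [Field k] {Γ Λ : Type u} [Ring Γ] [Algebra k Γ] [Ring Λ] [Algebra k Λ]
  {n : ℕ} (E : FreeArrowExtension k Γᵐᵒᵖ Λᵐᵒᵖ n)

include E

/-- The inflation to `Λ` of a `Γ`-module of finite projective dimension has finite projective
dimension as well, and at least the same. -/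
theorem findim_le_findim : findim Γ ≤ findim Λ := by
  refine iSup_le fun M => iSup_le fun hfin => iSup_le fun hpd => ?_
  let _ : Module k M := Module.compHom M (algebraMap k Γᵐᵒᵖ)
  have : IsScalarTower k Γᵐᵒᵖ M := ⟨fun c g x => by
    rw [Algebra.smul_def, mul_smul]
    rfl⟩
  let N := ModuleCat.of Λᵐᵒᵖ (E.Inflation M)
  have hN : E.Compatible (E.Inflation M) := E.compatible_inflation
  have hle : projectiveDimension M ≤ projectiveDimension N :=
    projectiveDimension_le_of_forall fun d hd => hN.hasProjectiveDimensionLT_restrict d hd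
  have hNpd : projectiveDimension N ≠ ⊤ := by
    rw [projectiveDimension_ne_top_iff] at hpd ⊢
    obtain ⟨d, hd⟩ := hpd
    exact ⟨d + 1, hN.hasProjectiveDimensionLT_add_two d
      (hasProjectiveDimensionLT_of_ge M (d + 1) (d + 2) (by omega))⟩
  have hNfin : Module.Finite Λᵐᵒᵖ N := by
    have : Module.Finite Γᵐᵒᵖ (E.Inflation M) := hfin
    exact hN.finite
  exact hle.trans (le_iSup_of_le N (le_iSup_of_le hNfin (le_iSup_of_le hNpd le_rfl)))

/-- The restriction to `Γ` of a `Λ`-module of finite projective dimension `d` has finite projective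
dimension as well, and `d` is at most the maximum of that dimension and `1`. -/
theorem findim_le_max [Module.Finite k Λ] : findim Λ ≤ max (findim Γ) 1 := by
  refine iSup_le fun M => iSup_le fun hfin => iSup_le fun hpd => ?_
  let _ : Module k M := Module.compHom M (algebraMap k Λᵐᵒᵖ)
  have : IsScalarTower k Λᵐᵒᵖ M := ⟨fun c g x => by
    rw [Algebra.smul_def, mul_smul]
    rfl⟩
  let _ : Module Γᵐᵒᵖ M := Module.compHom M (E.incl : Γᵐᵒᵖ →+* Λᵐᵒᵖ)
  have : IsScalarTower k Γᵐᵒᵖ M := ⟨fun c y x => by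
    change E.incl (c • y) • x = c • E.incl y • x
    rw [map_smul, smul_assoc]⟩
  have hM : E.Compatible M := fun _ _ => rfl
  let N := ModuleCat.of Γᵐᵒᵖ M
  have hle : projectiveDimension N ≤ projectiveDimension M :=
    projectiveDimension_le_of_forall fun d hd => hM.hasProjectiveDimensionLT_restrict d hd
  have hNpd : projectiveDimension N ≠ ⊤ := fun h => hpd (top_le_iff.1 (h ▸ hle))
  have : Module.Finite k Λᵐᵒᵖ := Module.Finite.equiv (MulOpposite.opLinearEquiv k)
  have : Module.Finite k M := Module.Finite.trans Λᵐᵒᵖ M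
  have hNfin : Module.Finite Γᵐᵒᵖ N := Module.Finite.of_restrictScalars_finite k Γᵐᵒᵖ M
  have hNle : projectiveDimension N ≤ findim Γ :=
    le_iSup_of_le N (le_iSup_of_le hNfin (le_iSup_of_le hNpd le_rfl))
  refine le_trans ?_ (max_le_max_right 1 hNle)
  refine sInf_le fun i hi => ?_
  obtain ⟨h1, h2⟩ := max_lt_iff.1 hi
  obtain ⟨d, rfl⟩ : ∃ d, i = d + 2 := by
    have : 1 < i := by exact_mod_cast h2
    exact ⟨i - 2, by omega⟩
  exact hM.hasProjectiveDimensionLT_add_two d (projectiveDimension_lt_iff.1 h1)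

end FreeArrowExtension

namespace IsArrowRemoval

variable {k : Type w} {V : Type u} [Quiver.{v} V] [Field k] [Fintype V]
  {I : TwoSidedIdeal (PathAlgebra k V)} {A : Set (QArrow V)} {Λ Γ : Type (max u v w)} [Ring Λ]
  [Algebra k Λ] [Ring Γ] [Algebra k Γ] {q : PathAlgebra k V →ₐ[k] Λ} {π : PathAlgebra k V →ₐ[k] Γ}

theorem nonempty_freeArrowExtension (h : IsArrowRemoval I A q π) (hA : A.Finite)
    (hfe : ∀ a ∈ A, ∀ b ∈ A, ∀ x, π (vertex k b.2.1) * x * π (vertex k a.1) = 0) :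
    ∃ n, Nonempty (FreeArrowExtension k Γᵐᵒᵖ Λᵐᵒᵖ n) := by
  classical
  obtain ⟨σ, hσ⟩ := h.exists_section
  obtain ⟨τ, hτ⟩ := h.exists_proj
  have := hA.to_subtype
  obtain ⟨n, ⟨ε⟩⟩ := Finite.exists_equiv_fin A
  have hσv : ∀ i, σ (π (vertex k i)) = q (vertex k i) := fun i => by rw [hσ, deletion_vertex]
  refine ⟨n, ⟨{
    incl := σ.op
    proj := τ.op
    src := fun i => MulOpposite.op (π (vertex k (ε.symm i).1.1))
    tgt := fun i => MulOpposite.op (π (vertex k (ε.symm i).1.2.1))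
    arrow := fun i => MulOpposite.op (q (arrow k (ε.symm i).1))
    proj_incl := fun g => ?_
    proj_arrow := fun i => ?_
    src_mul_src := fun i => ?_
    tgt_mul_tgt := fun i => ?_
    arrow_mul_src := fun i => ?_
    tgt_mul_arrow := fun i => ?_
    src_mul_mul_tgt := fun i j g => ?_
    adjoin_eq_top := ?_
    exists_lift := fun {B} _ _ ρ b hsrc htgt => ?_ }⟩⟩
  · obtain ⟨x, hx⟩ := h.surjective_pi g.unop
    refine MulOpposite.unop_injective ?_
    change τ (σ g.unop) = g.unop
    rw [← hx, hσ, hτ, h.pi_deletion]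
  · refine MulOpposite.unop_injective ?_
    change τ (q (arrow k (ε.symm i).1)) = 0
    rw [hτ, h.pi_arrow (ε.symm i).2]
  · rw [← MulOpposite.op_mul, ← map_mul, vertex_mul_self]
  · rw [← MulOpposite.op_mul, ← map_mul, vertex_mul_self]
  · refine MulOpposite.unop_injective ?_
    change σ (π (vertex k _)) * q (arrow k _) = q (arrow k _)
    rw [hσv, ← map_mul, vertex_mul_arrow]
  · refine MulOpposite.unop_injective ?_
    change q (arrow k _) * σ (π (vertex k _)) = q (arrow k _)
    rw [hσv, ← map_mul, arrow_mul_vertex]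
  · refine MulOpposite.unop_injective ?_
    change π (vertex k _) * (g.unop * π (vertex k _)) = 0
    rw [← mul_assoc]
    exact hfe _ (ε.symm i).2 _ (ε.symm j).2 g.unop
  · set T := Algebra.adjoin k (Set.range σ.op ∪
      Set.range fun i => MulOpposite.op (q (arrow k (ε.symm i).1)))
    have hT : ∀ g, MulOpposite.op (σ g) ∈ T := fun g =>
      Algebra.subset_adjoin (Or.inl ⟨MulOpposite.op g, rfl⟩)
    have hp : ∀ {i j : V} (p : Quiver.Path i j), MulOpposite.op (q (path k ⟨i, j, p⟩)) ∈ T := by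
      intro i j p
      induction p with
      | nil =>
        have := hT (π (vertex k i))
        rwa [hσv] at this
      | cons p b ih =>
        rw [path_cons, map_mul, MulOpposite.op_mul]
        refine mul_mem ?_ ih
        by_cases hb : (⟨_, _, b⟩ : QArrow V) ∈ A
        · exact Algebra.subset_adjoin (Or.inr ⟨ε ⟨_, hb⟩, by simp only [ε.symm_apply_apply]⟩)
        · have := hT (π (arrow k ⟨_, _, b⟩))
          rwa [hσ, deletion_arrow_of_notMem hb] at this
    have hq : ∀ x, MulOpposite.op (q x) ∈ T := fun x => by
      induction x using induction_path with
      | h0 => rw [map_zero, MulOpposite.op_zero]; exact zero_mem _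
      | hadd y z hy hz => rw [map_add, MulOpposite.op_add]; exact add_mem hy hz
      | hp c p => rw [map_smul, MulOpposite.op_smul]; exact T.smul_mem (hp p.2.2) c
    refine eq_top_iff.2 fun y _ => ?_
    obtain ⟨x, hx⟩ := h.surjective_q y.unop
    have hy := hq x
    rwa [hx, MulOpposite.op_unop] at hy
  · obtain ⟨θ, hθ, hθa⟩ := h.exists_lift hσ (AlgHom.opComm.symm ρ)
      (fun a => if ha : a ∈ A then MulOpposite.op (b (ε ⟨a, ha⟩)) else 0)
      (fun a ha => by
        rw [dif_pos ha]
        refine MulOpposite.unop_injective ?_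
        have := hsrc (ε ⟨a, ha⟩)
        rwa [ε.symm_apply_apply] at this)
      (fun a ha => by
        rw [dif_pos ha]
        refine MulOpposite.unop_injective ?_
        have := htgt (ε ⟨a, ha⟩)
        rwa [ε.symm_apply_apply] at this)
    refine ⟨AlgHom.opComm θ, fun g => ?_, fun i => ?_⟩
    · exact congrArg MulOpposite.unop (hθ g.unop)
    · have := congrArg MulOpposite.unop (hθa (ε.symm i).1 (ε.symm i).2)
      rw [dif_pos (ε.symm i).2] at this
      simpa using this

theorem findim_bounds (h : IsArrowRemoval I A q π) (hA : A.Finite) [Module.Finite k Λ]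
    (hfe : ∀ a ∈ A, ∀ b ∈ A, ∀ x, π (vertex k b.2.1) * x * π (vertex k a.1) = 0) :
    findim Λ ≤ max (findim Γ) 1 ∧ findim Γ ≤ max (findim Λ) 1 ∧
      (findim Λ < ⊤ ↔ findim Γ < ⊤) := by
  obtain ⟨n, ⟨E⟩⟩ := h.nonempty_freeArrowExtension hA hfe
  have h1 := E.findim_le_max
  have h2 := E.findim_le_findim
  refine ⟨h1, h2.trans (le_max_left _ _), fun h => h2.trans_lt h, fun h => h1.trans_lt ?_⟩
  exact max_lt h (WithBot.coe_lt_coe.2 (ENat.natCast_lt_top 1))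

end IsArrowRemoval

theorem AvoidsArrows.findim_bounds {k : Type w} {V : Type u} [Field k] [Quiver.{v} V] [Fintype V]
    [∀ i j : V, Finite (i ⟶ j)] {I : TwoSidedIdeal (PathAlgebra k V)} (hI : IsAdmissible I)
    {A : Set (QArrow V)} (h : AvoidsArrows I A)
    (hfe : ∀ a ∈ A, ∀ b ∈ A, ∀ x,
      removalMk I A (vertex k b.2.1) * x * removalMk I A (vertex k a.1) = 0) :
    findim (QuiverAlgebra I) ≤ max (findim (ArrowRemoval I A)) 1 ∧
      findim (ArrowRemoval I A) ≤ max (findim (QuiverAlgebra I)) 1 ∧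
      (findim (QuiverAlgebra I) < ⊤ ↔ findim (ArrowRemoval I A) < ⊤) := by
  obtain ⟨m, -, hm⟩ := hI.2
  have : Module.Finite k (QuiverAlgebra I) := finite_of_arrowIdeal_pow_le hm
  exact h.isArrowRemoval.findim_bounds A.toFinite hfe

theorem theoremA {k : Type w} {V : Type u} [Field k] [Quiver.{v} V] [Fintype V]
    [∀ i j : V, Finite (i ⟶ j)] (I : TwoSidedIdeal (PathAlgebra k V)) (hI : IsAdmissible I) :
    (∀ a : QArrow V,
      -- characterization of the given presentation
      (AvoidsArrows I {a} ↔
        HomVanishes (ArrowRemoval I {a}) (ArrowRemoval.cls I {a} (PathAlgebra.vertex k a.1))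
            (ArrowRemoval.cls I {a} (PathAlgebra.vertex k a.2.1)) ∧
          ∃ φ : QuiverAlgebra I ≃ₐ[k] RemovalTrivExt I a, IsIdentityOnRemoval I a φ) ∧
      -- in that case the isomorphism can be chosen to send `a` to `e ⊗ f`
      (AvoidsArrows I {a} →
        ∃ φ : QuiverAlgebra I ≃ₐ[k] RemovalTrivExt I a, IsIdentityOnRemoval I a φ ∧
          φ (QuiverAlgebra.cls I (PathAlgebra.arrow k a)) =
            TrivSqZeroExt.inr (ProjBimodule.gen k _ _)) ∧
      -- characterization up to a change of presentation
      (HomVanishes (ArrowRemoval I {a}) (ArrowRemoval.cls I {a} (PathAlgebra.vertex k a.1))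
            (ArrowRemoval.cls I {a} (PathAlgebra.vertex k a.2.1)) ∧
          Nonempty (QuiverAlgebra I ≃ₐ[k] RemovalTrivExt I a) ↔
        ∃ I' : TwoSidedIdeal (PathAlgebra k V), IsAdmissible I' ∧ AvoidsArrows I' {a} ∧
          I' ⊔ TwoSidedIdeal.span {PathAlgebra.arrow k a} =
            I ⊔ TwoSidedIdeal.span {PathAlgebra.arrow k a} ∧
          Nonempty (QuiverAlgebra I' ≃ₐ[k] QuiverAlgebra I)) ∧
      -- finitistic dimensions, one arrow
      (AvoidsArrows I {a} →
        findim (QuiverAlgebra I) ≤ max (findim (ArrowRemoval I {a})) 1 ∧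
        findim (ArrowRemoval I {a}) ≤ max (findim (QuiverAlgebra I)) 1 ∧
        (findim (QuiverAlgebra I) < ⊤ ↔ findim (ArrowRemoval I {a}) < ⊤))) ∧
    -- finitistic dimensions, several arrows
    (∀ A : Set (QArrow V), AvoidsArrows I A →
      (∀ a ∈ A, ∀ b ∈ A,
        HomVanishes (QuiverAlgebra I) (QuiverAlgebra.cls I (PathAlgebra.vertex k a.1))
          (QuiverAlgebra.cls I (PathAlgebra.vertex k b.2.1))) →
      findim (QuiverAlgebra I) ≤ max (findim (ArrowRemoval I A)) 1 ∧
      findim (ArrowRemoval I A) ≤ max (findim (QuiverAlgebra I)) 1 ∧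
      (findim (QuiverAlgebra I) < ⊤ ↔ findim (ArrowRemoval I A) < ⊤)) := by
  refine ⟨fun a => ⟨avoidsArrows_singleton_iff hI, fun h => (h.exists_isIdentityOnRemoval hI).2,
    nonempty_equiv_removalTrivExt_iff hI, fun h => h.findim_bounds hI ?_⟩, fun A h hom =>
      h.findim_bounds hI ?_⟩
  · rintro _ rfl _ rfl x
    exact homVanishes_removal_iff.1 (h.exists_isIdentityOnRemoval hI).1 x
  · intro a ha b hb x
    obtain ⟨y, rfl⟩ := Ideal.Quotient.mk_surjective x
    have he : QuiverAlgebra.cls I (vertex k a.1) * QuiverAlgebra.cls I (vertex k a.1) =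
        QuiverAlgebra.cls I (vertex k a.1) := by rw [← map_mul, vertex_mul_self]
    have := (homVanishes_iff he).1 (hom a ha b hb) y
    exact (congrArg (Ideal.Quotient.mk (removalIdeal I A).asIdeal) this).trans (map_zero _)
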